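/- Conventions. Inner products $\langle\cdot,\cdot\rangle$ are linear in the first argument. The CAR algebra $\mathfrak A(\mathcal H)$ over a complex Hilbert space $\mathcal H$ is the universal unital $C^*$-algebra generated by elements $a(h)$, $h\in\mathcal H$, such that $h\mapsto a^*(h):=a(h)^*$ is linear, $a(h)a(k)+a(k)a(h)=0$ and $a^*(h)a(k)+a(k)a^*(h)=\langle h,k\rangle 1$. A unitary $U$ on $\mathcal H$ gives the automorphism $\gamma_U$ with $\gamma_U(a(h))=a(Uh)$, and the GICAR algebra $\mathfrak I(\mathcal H)$ is the $C^*$-subalgebra of all $x\in\mathfrak A(\mathcal H)$ with $\gamma_{\lambda 1}(x)=x$ for all $\lambda\in\mathbb C$, $|\lambda|=1$; it is invariant under every $\gamma_U$. For a positive contraction $K$ on $\mathcal H$, $\varphi_K$ is the quasi-free state on $\mathfrak A(\mathcal H)$ with $$\varphi_K(a^*(h_n)\cdots a^*(h_1)a(k_1)\cdots a(k_m))=\delta_{n,m}\det[\langle Kh_i,k_j\rangle]_{i,j=1}^n\qquad(n,m\ge 0),$$ and $(\rho_K,\mathcal H_K,\Omega_K)$ is the GNS triple of $\varphi_K|_{\mathfrak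 I(\mathcal H)}$. The generator of a strongly continuous one-parameter unitary group $(V_t)_{t\in\mathbb R}$ is the operator $G$ with $G\xi=\lim_{t\to0}(V_t\xi-\xi)/(\mathrm i t)$, defined for all $\xi$ for which the limit exists, so that $V_t=e^{\mathrm i tG}$. Theorem. Let $\mathcal H$ be a separable complex Hilbert space, $A$ a (possibly unbounded) self-adjoint operator on $\mathcal H$, and $(v_\alpha)_{\alpha\in\mathcal I}$, with $\mathcal I$ countable, an orthonormal basis of $\mathcal H$ such that $v_\alpha\in\mathrm{dom}(A)$ and $Av_\alpha=m_\alpha v_\alpha$ with $m_\alpha\in\mathbb R$. Let $\mathcal I_0\subset\mathcal I$, and let $K$ be the orthogonal projection onto $\overline{\mathrm{span}}\{v_\alpha:\alpha\in\mathcal I_0\}$. There is exactly one strongly continuous one-parameter unitary group $(U_t)_{t\in\mathbb R}$ on $\mathcal H$ with generator $A$ (that is, $U_t=e^{\mathrm i tA}$), and exactly one strongly continuous one-parameter unitary group $(\Gamma_K(U_t))_{t\in\mathbb R}$ on $\mathcal H_K$ with $$\Gamma_K(U_t)\rho_K(x)\Omega_K=\rho_K(\gamma_{U_t}(x))\Omega_K\qquad(x\in\mathfrak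 I(\mathcal H),\ t\in\mathbb R).$$ Let $d\Gamma_K(A)$ be the generator of $(\Gamma_K(U_t))_{t\in\mathbb R}$, and let $\mathcal D\subset\mathcal H_K$ be the linear span of the vectors $$v_{\alpha_1,\dots,\alpha_n;\beta_1,\dots,\beta_n}:=\rho_K\bigl(a^*(v_{\alpha_1})\cdots a^*(v_{\alpha_n})a(v_{\beta_1})\cdots a(v_{\beta_n})\bigr)\Omega_K,\qquad n\ge 0,\ \alpha_i\in\mathcal I\setminus\mathcal I_0,\ \beta_i\in\mathcal I_0.$$ Then both series in $$\mathcal A\xi:=\sum_{\alpha\in\mathcal I\setminus\mathcal I_0}m_\alpha\,\rho_K(a^*(v_\alpha)a(v_\alpha))\xi-\sum_{\alpha\in\mathcal I_0}m_\alpha\,\rho_K(a(v_\alpha)a^*(v_\alpha))\xi$$ converge for every $\xi\in\mathcal D$, the operator $\mathcal A$ with domain $\mathcal D$ is closable, and its closure is $d\Gamma_K(A)$. -/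

import Mathlib

open scoped ComplexOrder InnerProductSpace ENNReal symmDiff

universe u

noncomputable section

/-! ### The CAR algebra -/

/-- The canonical anticommutation relations for an antilinear map `h ↦ a(h)` into a unital
C*-algebra. Mathlib's inner product `⟪k, h⟫_ℂ` is linear in `h` and antilinear in `k`. -/
structure IsCAR {H : Type*} [NormedAddCommGroup H] [InnerProductSpace ℂ H]
    {B : Type*} [CStarAlgebra B] (a : H →ₗ⋆[ℂ] B) : Prop where
  anticomm : ∀ h k, a h * a k + a k * a h = 0
  anticomm_star : ∀ h k, star (a h) * a k + a k * star (a h) = algebraMap ℂ B ⟪k, h⟫_ℂ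

theorem norm_le_of_anticomm {B : Type*} [CStarAlgebra B] {x : B} {c : ℝ} (hc : 0 ≤ c)
    (h1 : star x * x + x * star x = algebraMap ℂ B ((c ^ 2 : ℝ) : ℂ)) : ‖x‖ ≤ c := by
  let _ := CStarAlgebra.spectralOrder B
  let _ := CStarAlgebra.spectralOrderedRing B
  rcases subsingleton_or_nontrivial B with hB | hB
  · rw [Subsingleton.elim x 0, norm_zero]; exact hc
  have h2 : star x * x ≤ algebraMap ℂ B ((c ^ 2 : ℝ) : ℂ) := by
    rw [← h1]; exact le_add_of_nonneg_right (mul_star_self_nonneg _)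
  have h3 := CStarAlgebra.norm_le_norm_of_nonneg_of_le (star_mul_self_nonneg x) h2
  rw [CStarRing.norm_star_mul_self, norm_algebraMap', Complex.norm_real, norm_pow,
    Real.norm_of_nonneg hc] at h3
  nlinarith [norm_nonneg x]

theorem IsCAR.norm_le {H : Type*} [NormedAddCommGroup H] [InnerProductSpace ℂ H]
    {B : Type*} [CStarAlgebra B] {a : H →ₗ⋆[ℂ] B} (ha : IsCAR a) (h : H) : ‖a h‖ ≤ ‖h‖ := by
  refine norm_le_of_anticomm (norm_nonneg h) ?_
  rw [ha.anticomm_star, inner_self_eq_norm_sq_to_K]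
  simp

/-- A representation of the canonical anticommutation relations over `H` in a nonzero unital
C*-algebra. -/
structure CARRep (H : Type u) [NormedAddCommGroup H] [InnerProductSpace ℂ H] : Type (u + 1) where
  B : Type u
  [cstar : CStarAlgebra B]
  [nontrivial : Nontrivial B]
  a : H →ₗ⋆[ℂ] B
  isCAR : IsCAR a

attribute [instance] CARRep.cstar CARRep.nontrivial

section CAR
variable {H : Type u} [NormedAddCommGroup H] [InnerProductSpace ℂ H]

/-- The representation `h ↦ a(U h)`. -/
def CARRep.comp (π : CARRep H) (U : H ≃ₗᵢ[ℂ] H) : CARRep H where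
  B := π.B
  a := π.a.comp (U.toLinearEquiv : H →ₗ[ℂ] H)
  isCAR :=
    { anticomm := fun h k => π.isCAR.anticomm (U h) (U k)
      anticomm_star := fun h k => by
        simpa [U.inner_map_map] using π.isCAR.anticomm_star (U h) (U k) }

theorem CARRep.comp_comm (π : CARRep H) {U W : H ≃ₗᵢ[ℂ] H} (h : ∀ x, U (W x) = W (U x)) :
    (π.comp U).comp W = (π.comp W).comp U := by
  unfold CARRep.comp
  congr 1
  ext x
  exact congrArg π.a (h x)

variable (H) in
/-- The bounded families indexed by all representations, with the supremum norm. -/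
abbrev CARProd : Type (u + 1) := lp (fun π : CARRep H => π.B) ∞

instance : CStarAlgebra (CARProd H) where

/-- The family of the operators `a(h)` in all representations. -/
def CARProd.a (h : H) : CARProd H :=
  ⟨fun π => π.a h, memℓp_infty ⟨‖h‖, by rintro _ ⟨π, rfl⟩; exact π.isCAR.norm_le h⟩⟩

/-- Reindexing along `π ↦ π.comp U`. -/
def CARProd.bogoliubov (U : H ≃ₗᵢ[ℂ] H) : CARProd H →⋆ₐ[ℂ] CARProd H where
  toFun x := ⟨fun π => x (π.comp U), memℓp_infty ⟨‖x‖, by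
    rintro _ ⟨π, rfl⟩; exact lp.norm_apply_le_norm ENNReal.top_ne_zero x (π.comp U)⟩⟩
  map_one' := rfl
  map_mul' _ _ := rfl
  map_zero' := rfl
  map_add' _ _ := rfl
  commutes' _ := rfl
  map_star' _ := rfl

variable (H) in
/-- The C*-subalgebra of the product that is generated by the families `a(h)`. -/
def CARProd.carSubalgebra : StarSubalgebra ℂ (CARProd H) :=
  (StarAlgebra.adjoin ℂ (Set.range (CARProd.a (H := H)))).topologicalClosure

instance : IsClosed (CARProd.carSubalgebra H : Set (CARProd H)) :=
  StarSubalgebra.isClosed_topologicalClosure _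

theorem CARProd.bogoliubov_mem (U : H ≃ₗᵢ[ℂ] H) {x : CARProd H}
    (hx : x ∈ CARProd.carSubalgebra H) :
    CARProd.bogoliubov U x ∈ CARProd.carSubalgebra H := by
  have hc : Continuous (CARProd.bogoliubov U) :=
    AddMonoidHomClass.continuous_of_bound (CARProd.bogoliubov U) 1 fun y => by
      rw [one_mul]; exact NonUnitalStarAlgHom.norm_apply_le (CARProd.bogoliubov U) y
  have hle : StarAlgebra.adjoin ℂ (Set.range (CARProd.a (H := H))) ≤
      (StarAlgebra.adjoin ℂ (Set.range (CARProd.a (H := H)))).comap (CARProd.bogoliubov U) := by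
    refine StarAlgebra.adjoin_le ?_
    rintro _ ⟨h, rfl⟩
    exact StarAlgebra.subset_adjoin ℂ _ ⟨U h, rfl⟩
  exact map_mem_closure hc hx fun y hy => hle hy

variable (H) in
/-- The CAR algebra over `H`: the universal unital C*-algebra generated by elements `a(h)` subject
to the canonical anticommutation relations. It is realized inside the product of all
representations; the norm of a polynomial in the generators is the supremum of its norms in all
representations, and the homomorphism to a given representation `π` is the evaluation at `π`. -/
def CARAlgebra : Type (u + 1) := CARProd.carSubalgebra H

namespace CARAlgebra

instance : CStarAlgebra (CARAlgebra H) := inferInstanceAs (CStarAlgebra (CARProd.carSubalgebra H))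

instance : PartialOrder (CARAlgebra H) := CStarAlgebra.spectralOrder _

instance : StarOrderedRing (CARAlgebra H) := CStarAlgebra.spectralOrderedRing _

/-- The homomorphism to a given representation. -/
def eval (π : CARRep H) : CARAlgebra H →⋆ₐ[ℂ] π.B where
  toFun x := x.1 π
  map_one' := rfl
  map_mul' _ _ := rfl
  map_zero' := rfl
  map_add' _ _ := rfl
  commutes' _ := rfl
  map_star' _ := rfl

theorem ext_eval {x y : CARAlgebra H} (h : ∀ π, eval π x = eval π y) : x = y :=
  Subtype.ext (lp.ext (funext h))

/-- The annihilation operators `a(h)`; the creation operators are `a*(h) = star (a h)`. -/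
def a : H →ₗ⋆[ℂ] CARAlgebra H where
  toFun h := ⟨CARProd.a h, subset_closure (StarAlgebra.subset_adjoin ℂ _ ⟨h, rfl⟩)⟩
  map_add' h k := ext_eval fun π => π.a.map_add h k
  map_smul' c h := ext_eval fun π => π.a.map_smulₛₗ c h

theorem eval_a (π : CARRep H) (h : H) : eval π (a h) = π.a h := rfl

theorem isCAR_a : IsCAR (a (H := H)) where
  anticomm h k := ext_eval fun π => π.isCAR.anticomm h k
  anticomm_star h k := ext_eval fun π => π.isCAR.anticomm_star h k

theorem exists_lift {B : Type u} [CStarAlgebra B] [Nontrivial B] {f : H →ₗ⋆[ℂ] B} (hf : IsCAR f) :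
    ∃ ρ : CARAlgebra H →⋆ₐ[ℂ] B, ∀ h, ρ (a h) = f h :=
  ⟨eval { B := B, a := f, isCAR := hf }, fun _ => rfl⟩

/-- The Bogoliubov transform `γ_U`. -/
def bogoliubov (U : H ≃ₗᵢ[ℂ] H) : CARAlgebra H →⋆ₐ[ℂ] CARAlgebra H where
  toFun x := ⟨CARProd.bogoliubov U x.1, CARProd.bogoliubov_mem U x.2⟩
  map_one' := rfl
  map_mul' _ _ := rfl
  map_zero' := rfl
  map_add' _ _ := rfl
  commutes' _ := rfl
  map_star' _ := rfl

theorem bogoliubov_a (U : H ≃ₗᵢ[ℂ] H) (h : H) : bogoliubov U (a h) = a (U h) := rfl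

theorem apply_comp_comm (x : CARAlgebra H) (π : CARRep H) {U W : H ≃ₗᵢ[ℂ] H}
    (h : ∀ x, U (W x) = W (U x)) :
    (x.1 ((π.comp U).comp W) : π.B) = (x.1 ((π.comp W).comp U) : π.B) := by
  have key : ∀ σ τ : CARRep H, σ = τ → HEq (x.1 σ) (x.1 τ) := by rintro σ _ rfl; rfl
  exact eq_of_heq (key _ _ (π.comp_comm h))

theorem bogoliubov_comm {U W : H ≃ₗᵢ[ℂ] H} (h : ∀ x, U (W x) = W (U x)) (x : CARAlgebra H) :
    bogoliubov U (bogoliubov W x) = bogoliubov W (bogoliubov U x) :=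
  ext_eval fun π => x.apply_comp_comm π h

theorem continuous_bogoliubov (U : H ≃ₗᵢ[ℂ] H) : Continuous (bogoliubov U) :=
  AddMonoidHomClass.continuous_of_bound (bogoliubov U) 1 fun y => by
    rw [one_mul]; exact NonUnitalStarAlgHom.norm_apply_le (bogoliubov U) y

end CARAlgebra

/-! ### The gauge action and the GICAR algebra -/

variable (H) in
/-- Multiplication by a complex number of modulus one. -/
def gaugeUnitary (z : Circle) : H ≃ₗᵢ[ℂ] H where
  toLinearEquiv := LinearEquiv.smulOfNeZero ℂ H (z : ℂ) (Circle.coe_ne_zero z)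
  norm_map' x := by
    change ‖(z : ℂ) • x‖ = ‖x‖
    rw [norm_smul, Circle.norm_coe, one_mul]

theorem gaugeUnitary_apply (z : Circle) (x : H) : gaugeUnitary H z x = (z : ℂ) • x := rfl

open CARAlgebra in
variable (H) in
/-- The fixed points of the gauge action. -/
def gicarSubalgebra : StarSubalgebra ℂ (CARAlgebra H) where
  carrier := {x | ∀ z : Circle, bogoliubov (gaugeUnitary H z) x = x}
  mul_mem' hx hy z := by rw [map_mul, hx z, hy z]
  add_mem' hx hy z := by rw [map_add, hx z, hy z]
  algebraMap_mem' c z := AlgHomClass.commutes _ c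
  star_mem' hx z := by rw [map_star, hx z]

instance : IsClosed (gicarSubalgebra H : Set (CARAlgebra H)) := by
  change IsClosed {x : CARAlgebra H | ∀ z : Circle,
    CARAlgebra.bogoliubov (gaugeUnitary H z) x = x}
  simp only [Set.ofPred_forall]
  exact isClosed_iInter fun z => isClosed_eq (CARAlgebra.continuous_bogoliubov _) continuous_id

variable (H) in
/-- The GICAR algebra over `H`. -/
def GICAR : Type (u + 1) := gicarSubalgebra H

namespace GICAR

open CARAlgebra

instance : CStarAlgebra (GICAR H) := inferInstanceAs (CStarAlgebra (gicarSubalgebra H))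

instance : PartialOrder (GICAR H) := CStarAlgebra.spectralOrder _

instance : StarOrderedRing (GICAR H) := CStarAlgebra.spectralOrderedRing _

/-- The inclusion into the CAR algebra. -/
def incl : GICAR H →⋆ₐ[ℂ] CARAlgebra H := (gicarSubalgebra H).subtype

/-- The restriction of the Bogoliubov transform `γ_U` to the GICAR algebra. -/
def bogoliubov (U : H ≃ₗᵢ[ℂ] H) : GICAR H →⋆ₐ[ℂ] GICAR H where
  toFun x := ⟨CARAlgebra.bogoliubov U x.1, fun z => by
    rw [bogoliubov_comm (fun y => by simp [gaugeUnitary_apply]), x.2 z]⟩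
  map_one' := Subtype.ext (map_one (CARAlgebra.bogoliubov U))
  map_mul' x y := Subtype.ext (map_mul (CARAlgebra.bogoliubov U) x.1 y.1)
  map_zero' := Subtype.ext (map_zero (CARAlgebra.bogoliubov U))
  map_add' x y := Subtype.ext (map_add (CARAlgebra.bogoliubov U) x.1 y.1)
  commutes' c := Subtype.ext (AlgHomClass.commutes (CARAlgebra.bogoliubov U) c)
  map_star' x := Subtype.ext (map_star (CARAlgebra.bogoliubov U) x.1)

theorem gauge_a (z : Circle) (h : H) :
    CARAlgebra.bogoliubov (gaugeUnitary H z) (a h) = star (z : ℂ) • a h := by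
  rw [bogoliubov_a, gaugeUnitary_apply, map_smulₛₗ]; rfl

theorem gauge_star_a (z : Circle) (h : H) :
    CARAlgebra.bogoliubov (gaugeUnitary H z) (star (a h)) = (z : ℂ) • star (a h) := by
  rw [map_star, gauge_a, star_smul, star_star]

theorem circle_mul_star (z : Circle) : (z : ℂ) * star (z : ℂ) = 1 := by
  change (z : ℂ) * (starRingEnd ℂ) (z : ℂ) = 1
  rw [Complex.mul_conj', Circle.norm_coe]; simp

theorem gauge_prod_a (z : Circle) {n : ℕ} (k : Fin n → H) :
    CARAlgebra.bogoliubov (gaugeUnitary H z) (List.ofFn fun i => a (k i)).prod =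
      star (z : ℂ) ^ n • (List.ofFn fun i => a (k i)).prod := by
  induction n with
  | zero => simp
  | succ n ih =>
    simp only [List.ofFn_succ, List.prod_cons, map_mul, gauge_a, ih fun i => k i.succ,
      smul_mul_smul_comm, pow_succ']

theorem gauge_prod_star_a (z : Circle) {n : ℕ} (h : Fin n → H) :
    CARAlgebra.bogoliubov (gaugeUnitary H z) (List.ofFn fun i => star (a (h i))).prod =
      (z : ℂ) ^ n • (List.ofFn fun i => star (a (h i))).prod := by
  induction n with
  | zero => simp
  | succ n ih =>
    simp only [List.ofFn_succ, List.prod_cons, map_mul, gauge_star_a, ih fun i => h i.succ,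
      smul_mul_smul_comm, pow_succ']

/-- The element `a*(h₁) ⋯ a*(hₙ) a(k₁) ⋯ a(kₙ)`. -/
def monomial {n : ℕ} (h k : Fin n → H) : GICAR H :=
  ⟨(List.ofFn fun i => star (a (h i))).prod * (List.ofFn fun i => a (k i)).prod, fun z => by
    rw [map_mul, gauge_prod_star_a, gauge_prod_a, smul_mul_smul_comm, ← mul_pow, circle_mul_star,
      one_pow, one_smul]⟩

/-- The element `a*(h) a(k)`. -/
def creAnn (h k : H) : GICAR H :=
  ⟨star (a h) * a k, fun z => by
    rw [map_mul, gauge_star_a, gauge_a, smul_mul_smul_comm, circle_mul_star, one_smul]⟩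

/-- The element `a(h) a*(k)`. -/
def annCre (h k : H) : GICAR H :=
  ⟨a h * star (a k), fun z => by
    rw [map_mul, gauge_star_a, gauge_a, smul_mul_smul_comm, mul_comm (star _), circle_mul_star,
      one_smul]⟩

end GICAR

end CAR

/-! ### The Fock representation -/

namespace Fock
variable {J : Type u} [LinearOrder J]

/-- The antisymmetric Fock space in the occupation number picture: the basis vectors are
labelled by the finite sets of occupied modes. -/
abbrev Space (J : Type u) : Type u := lp (fun _ : Finset J => ℂ) 2

/-- Change of the occupation of the mode `j`. -/
def flip (j : J) : Finset J ≃ Finset J where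
  toFun S := S ∆ {j}
  invFun S := S ∆ {j}
  left_inv S := by simp
  right_inv S := by simp

theorem flip_flip (j : J) (S : Finset J) : flip j (flip j S) = S := (flip j).left_inv S

theorem flip_comm (j k : J) (S : Finset J) : flip j (flip k S) = flip k (flip j S) := by
  simp [flip, symmDiff_right_comm]

theorem mem_flip_self (j : J) (S : Finset J) : j ∈ flip j S ↔ j ∉ S := by
  simp [flip, Finset.mem_symmDiff]

theorem mem_flip_of_ne {j k : J} (h : j ≠ k) (S : Finset J) : j ∈ flip k S ↔ j ∈ S := by
  simp [flip, Finset.mem_symmDiff, h]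

theorem memlp_flip (g : Finset J → ℂ) (hg : ∀ S, ‖g S‖ ≤ 1) (j : J) (f : Space J) :
    Memℓp (fun S => g S * f (flip j S)) 2 := by
  have h2 : (0 : ℝ) < (2 : ℝ≥0∞).toReal := by simp
  have hf : Summable fun S => ‖f S‖ ^ (2 : ℝ≥0∞).toReal := (memℓp_gen_iff h2).1 (lp.memℓp f)
  refine (memℓp_gen_iff h2).2 (Summable.of_nonneg_of_le (fun _ => by positivity) (fun S => ?_)
    ((flip j).summable_iff.2 hf))
  simp only [Function.comp, norm_mul]
  gcongr
  exact mul_le_of_le_one_left (norm_nonneg _) (hg S)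

/-- The operator `(T f)(S) = g(S) f(S ∆ {j})`. -/
def weighted (g : Finset J → ℂ) (hg : ∀ S, ‖g S‖ ≤ 1) (j : J) : Space J →L[ℂ] Space J :=
  LinearMap.mkContinuous
    { toFun := fun f => ⟨fun S => g S * f (flip j S), memlp_flip g hg j f⟩
      map_add' := fun f f' => by ext S; exact mul_add _ _ _
      map_smul' := fun c f => by ext S; simp [mul_left_comm] } 1 (fun f => by
    have h2 : (0 : ℝ) < (2 : ℝ≥0∞).toReal := by simp
    have hf : Summable fun S => ‖f S‖ ^ (2 : ℝ≥0∞).toReal := (memℓp_gen_iff h2).1 (lp.memℓp f)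
    rw [one_mul]
    refine lp.norm_le_of_tsum_le h2 (norm_nonneg _) ?_
    rw [lp.norm_rpow_eq_tsum h2, ← (flip j).tsum_eq fun S => ‖f S‖ ^ (2 : ℝ≥0∞).toReal]
    refine Summable.tsum_le_tsum (fun S => ?_) ((memℓp_gen_iff h2).1 (memlp_flip g hg j f))
      ((flip j).summable_iff.2 hf)
    simp only [LinearMap.coe_mk, AddHom.coe_mk, norm_mul]
    gcongr
    exact mul_le_of_le_one_left (norm_nonneg _) (hg S))

theorem weighted_apply (g : Finset J → ℂ) (hg : ∀ S, ‖g S‖ ≤ 1) (j : J) (f : Space J)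
    (S : Finset J) : weighted g hg j f S = g S * f (flip j S) := rfl

/-- The sign `(-1)^#{i ∈ S : i < j}`. -/
def sgn (j : J) (S : Finset J) : ℂ := ∏ i ∈ S, if i < j then -1 else 1

theorem sgn_cases (j : J) (S : Finset J) : sgn j S = 1 ∨ sgn j S = -1 := by
  unfold sgn
  induction S using Finset.induction_on with
  | empty => simp
  | insert i S hi ih => rw [Finset.prod_insert hi]; rcases ih with h | h <;> rw [h] <;> split_ifs <;> simp

theorem sgn_mul_self (j : J) (S : Finset J) : sgn j S * sgn j S = 1 := by
  rcases sgn_cases j S with h | h <;> simp [h]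

theorem norm_sgn (j : J) (S : Finset J) : ‖sgn j S‖ = 1 := by
  rcases sgn_cases j S with h | h <;> simp [h]

theorem star_sgn (j : J) (S : Finset J) : (starRingEnd ℂ) (sgn j S) = sgn j S := by
  rcases sgn_cases j S with h | h <;> simp [h]

theorem sgn_flip (k j : J) (S : Finset J) :
    sgn k (flip j S) = (if j < k then -1 else 1) * sgn k S := by
  by_cases hj : j ∈ S
  · have : flip j S = S.erase j := by
      ext i; by_cases h : i = j <;> simp [flip, Finset.mem_symmDiff, h, hj]
    rw [this, sgn, sgn, ← Finset.mul_prod_erase S _ hj, ← mul_assoc]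
    split_ifs <;> simp
  · have : flip j S = insert j S := by
      ext i; by_cases h : i = j <;> simp [flip, Finset.mem_symmDiff, h, hj]
    rw [this, sgn, sgn, Finset.prod_insert hj]

def wAnn (j : J) (S : Finset J) : ℂ := if j ∈ S then 0 else sgn j S
def wCre (j : J) (S : Finset J) : ℂ := if j ∈ S then sgn j S else 0

theorem norm_wAnn (j : J) (S : Finset J) : ‖wAnn j S‖ ≤ 1 := by
  unfold wAnn; split_ifs <;> simp [norm_sgn]
theorem norm_wCre (j : J) (S : Finset J) : ‖wCre j S‖ ≤ 1 := by
  unfold wCre; split_ifs <;> simp [norm_sgn]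

/-- The annihilation operator of the mode `j`. -/
def ann (j : J) : Space J →L[ℂ] Space J := weighted (wAnn j) (norm_wAnn j) j
/-- The creation operator of the mode `j`. -/
def cre (j : J) : Space J →L[ℂ] Space J := weighted (wCre j) (norm_wCre j) j

theorem star_ann (j : J) : star (ann j) = cre j := by
  symm
  rw [ContinuousLinearMap.star_eq_adjoint, ContinuousLinearMap.eq_adjoint_iff]
  intro x y
  rw [lp.inner_eq_tsum, lp.inner_eq_tsum, ← (flip j).tsum_eq]
  refine tsum_congr fun S => ?_
  have h : wCre j (flip j S) = wAnn j S := by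
    simp only [wCre, wAnn, mem_flip_self, sgn_flip, lt_irrefl, if_false, one_mul]
    split_ifs <;> simp_all
  have h' : (starRingEnd ℂ) (wAnn j S) = wAnn j S := by
    unfold wAnn; split_ifs <;> simp [star_sgn]
  simp only [cre, ann, weighted_apply, RCLike.inner_apply, map_mul, h, h', flip_flip]
  ring

theorem ann_ann (j k : J) : ann j * ann k + ann k * ann j = 0 := by
  ext f S
  change wAnn j S * (wAnn k (flip j S) * f (flip k (flip j S))) +
    wAnn k S * (wAnn j (flip k S) * f (flip j (flip k S))) = 0
  rw [flip_comm j k]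
  rcases eq_or_ne j k with rfl | hjk
  · simp only [wAnn, mem_flip_self]; split_ifs <;> simp_all
  · simp only [wAnn, mem_flip_of_ne hjk, mem_flip_of_ne hjk.symm, sgn_flip]
    rcases lt_or_gt_of_ne hjk with h | h <;> simp only [h, not_lt_of_gt h, if_true, if_false] <;>
      split_ifs <;> ring

theorem cre_ann (j k : J) : cre j * ann k + ann k * cre j = if j = k then 1 else 0 := by
  ext f S
  have h0 : (cre j * ann k + ann k * cre j) f S =
    wCre j S * (wAnn k (flip j S) * f (flip k (flip j S))) +
    wAnn k S * (wCre j (flip k S) * f (flip j (flip k S))) := rfl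
  rw [h0, flip_comm j k]
  rcases eq_or_ne j k with rfl | hjk
  · have := sgn_mul_self j S
    simp only [wAnn, wCre, mem_flip_self, flip_flip, sgn_flip, lt_irrefl, if_false, one_mul, if_true]
    by_cases hS : j ∈ S
    · simp [hS, ← mul_assoc, this]
    · simp [hS, ← mul_assoc, this]
  · simp only [wAnn, wCre, mem_flip_of_ne hjk, mem_flip_of_ne hjk.symm, sgn_flip, if_neg hjk]
    rcases lt_or_gt_of_ne hjk with h | h <;> simp only [h, not_lt_of_gt h, if_true, if_false] <;>
      split_ifs <;> simp <;> ring

/-- The vacuum vector. -/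
def vac : Space J := lp.single 2 ∅ 1

theorem ann_vac (j : J) : ann j (vac : Space J) = 0 := by
  ext S
  rw [ann, weighted_apply]
  by_cases h : j ∈ S
  · simp [wAnn, h]
  · have : flip j S ≠ ∅ := fun h' => by
      have := (mem_flip_self j S).2 h
      rw [h'] at this; simp at this
    simp [vac, lp.single_apply, this]

variable {E : Type*} [NormedAddCommGroup E] [InnerProductSpace ℂ E] (b : HilbertBasis J ℂ E)

def term (h : E) (j : J) : Space J →L[ℂ] Space J := ⟪h, b j⟫_ℂ • ann j

theorem anticomm_sum (h k : E) (T : Finset J) :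
    (∑ j ∈ T, term b h j) * (∑ j ∈ T, term b k j) +
      (∑ j ∈ T, term b k j) * (∑ j ∈ T, term b h j) = 0 := by
  rw [Finset.sum_mul_sum, Finset.sum_mul_sum, Finset.sum_comm, ← Finset.sum_add_distrib]
  refine Finset.sum_eq_zero fun i _ => ?_
  rw [← Finset.sum_add_distrib]
  refine Finset.sum_eq_zero fun j _ => ?_
  simp only [term, smul_mul_smul_comm]
  rw [mul_comm ⟪k, b i⟫_ℂ, ← smul_add, ann_ann, smul_zero]

theorem anticomm_star_sum (h k : E) (T : Finset J) :
    star (∑ j ∈ T, term b h j) * (∑ j ∈ T, term b k j) +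
      (∑ j ∈ T, term b k j) * star (∑ j ∈ T, term b h j) =
      algebraMap ℂ _ (∑ j ∈ T, ⟪k, b j⟫_ℂ * ⟪b j, h⟫_ℂ) := by
  rw [star_sum, Finset.sum_mul_sum, Finset.sum_mul_sum, Finset.sum_comm (s := T) (t := T)
    (f := fun i j => term b k i * star (term b h j)), ← Finset.sum_add_distrib, map_sum]
  refine Finset.sum_congr rfl fun i hi => ?_
  rw [← Finset.sum_add_distrib, Finset.sum_eq_single i]
  · simp only [term, star_smul, smul_mul_smul_comm, star_ann]
    rw [mul_comm (star _), ← smul_add, cre_ann, if_pos rfl, Algebra.algebraMap_eq_smul_one]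
    simp
  · intro j _ hj
    simp only [term, star_smul, smul_mul_smul_comm, star_ann]
    rw [mul_comm (star _), ← smul_add, cre_ann, if_neg hj.symm, smul_zero]
  · exact fun h => absurd hi h

theorem summable_term (h : E) : Summable (term b h) := by
  rw [summable_iff_vanishing_norm]
  intro ε hε
  have hs : Summable fun j => ‖⟪h, b j⟫_ℂ‖ ^ 2 := by
    have := (b.summable_inner_mul_inner h h).norm
    refine this.congr fun j => ?_
    rw [norm_mul, norm_inner_symm (b j) h, sq]
  obtain ⟨s, hs⟩ := (summable_iff_vanishing_norm.1 hs) (ε ^ 2) (by positivity)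
  refine ⟨s, fun t ht => ?_⟩
  have h1 := hs t ht
  rw [Real.norm_of_nonneg (Finset.sum_nonneg fun _ _ => by positivity)] at h1
  have h2 : ‖∑ j ∈ t, term b h j‖ ≤ √(∑ j ∈ t, ‖⟪h, b j⟫_ℂ‖ ^ 2) := by
    refine norm_le_of_anticomm (Real.sqrt_nonneg _) ?_
    rw [anticomm_star_sum, Real.sq_sqrt (Finset.sum_nonneg fun _ _ => by positivity)]
    push_cast
    congr 1
    refine Finset.sum_congr rfl fun j _ => ?_
    rw [← inner_conj_symm (b j) h, Complex.mul_conj']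
  refine h2.trans_lt ?_
  rw [Real.sqrt_lt' hε]
  exact h1

/-- The annihilation operators `a(h) = ∑ⱼ ⟪h, bⱼ⟫ aⱼ`. -/
def a : E →ₗ⋆[ℂ] (Space J →L[ℂ] Space J) where
  toFun h := ∑' j, term b h j
  map_add' h k := by
    rw [← (summable_term b h).tsum_add (summable_term b k)]
    refine tsum_congr fun j => ?_
    simp [term, add_smul]
  map_smul' c h := by
    rw [← tsum_const_smul'']
    refine tsum_congr fun j => ?_
    simp [term, smul_smul, mul_comm]

theorem hasSum_a (h : E) : HasSum (term b h) (a b h) := (summable_term b h).hasSum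

theorem isCAR_a : IsCAR (a b) where
  anticomm h k := by
    have h1 := (Filter.Tendsto.mul (hasSum_a b h) (hasSum_a b k)).add
      (Filter.Tendsto.mul (hasSum_a b k) (hasSum_a b h))
    refine tendsto_nhds_unique h1 ?_
    simp only [anticomm_sum]
    exact tendsto_const_nhds
  anticomm_star h k := by
    have h0 : Filter.Tendsto (fun T : Finset J => star (∑ j ∈ T, term b h j)) Filter.atTop
      (nhds (star (a b h))) := (continuous_star.tendsto _).comp (hasSum_a b h)
    have h1 := (h0.mul (hasSum_a b k)).add (Filter.Tendsto.mul (hasSum_a b k) h0)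
    refine tendsto_nhds_unique h1 ?_
    simp only [anticomm_star_sum]
    exact ((algebraMapCLM ℂ _).continuous.tendsto _).comp (b.hasSum_inner_mul_inner k h)

theorem a_vac (h : E) : a b h (vac : Space J) = 0 := by
  have h1 := (ContinuousLinearMap.apply ℂ (Space J) (vac : Space J)).hasSum (hasSum_a b h)
  refine h1.unique ?_
  have : (fun j => (ContinuousLinearMap.apply ℂ (Space J) (vac : Space J)) (term b h j)) = 0 := by
    funext j; simp [term, ann_vac]
  rw [this]
  exact hasSum_zero

section Gram
variable {E : Type*} [NormedAddCommGroup E] [InnerProductSpace ℂ E]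
  {F : Type*} [NormedAddCommGroup F] [InnerProductSpace ℂ F] [CompleteSpace F]

/-- The vector `a*(f₁) ⋯ a*(fₙ) Ω`. -/
def wedge (a : E →ₗ⋆[ℂ] (F →L[ℂ] F)) (Ω : F) {n : ℕ} (f : Fin n → E) : F := (List.ofFn fun i => star (a (f i))).prod Ω

theorem wedge_zero {a : E →ₗ⋆[ℂ] (F →L[ℂ] F)} (Ω : F) (f : Fin 0 → E) : wedge a Ω f = Ω := by simp [wedge]

theorem wedge_succ {a : E →ₗ⋆[ℂ] (F →L[ℂ] F)} (Ω : F) {n : ℕ} (f : Fin (n + 1) → E) :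
    wedge a Ω f = star (a (f 0)) (wedge a Ω fun i => f i.succ) := by
  simp [wedge, List.ofFn_succ]

theorem ann_cre_apply {a : E →ₗ⋆[ℂ] (F →L[ℂ] F)} (ha : IsCAR a) (h g : E) (x : F) :
    a h (star (a g) x) = ⟪h, g⟫_ℂ • x - star (a g) (a h x) := by
  have := congrArg (fun T : F →L[ℂ] F => T x) (ha.anticomm_star g h)
  rw [Algebra.algebraMap_eq_smul_one] at this
  change star (a g) (a h x) + a h (star (a g) x) = ⟪h, g⟫_ℂ • x at this
  rw [← this]; abel

theorem ann_wedge {a : E →ₗ⋆[ℂ] (F →L[ℂ] F)} (ha : IsCAR a) (Ω : F)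
    (hΩ : ∀ h, a h Ω = 0) {n : ℕ} (h : E) (g : Fin (n + 1) → E) :
    a h (wedge a Ω g) =
      ∑ j : Fin (n + 1), ((-1) ^ (j : ℕ) * ⟪h, g j⟫_ℂ) • wedge a Ω fun i => g (j.succAbove i) := by
  induction n with
  | zero => rw [wedge_succ, ann_cre_apply ha, wedge_zero, hΩ]; simp [wedge_zero]
  | succ n ih =>
    rw [wedge_succ, ann_cre_apply ha, ih, map_sum, Fin.sum_univ_succ (n := n + 1), sub_eq_add_neg,
      ← Finset.sum_neg_distrib]
    congr 1
    · simp
    · refine Finset.sum_congr rfl fun j _ => ?_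
      rw [wedge_succ (n := n) (f := fun i => g (j.succ.succAbove i))]
      simp [pow_succ]

theorem inner_wedge {a : E →ₗ⋆[ℂ] (F →L[ℂ] F)} (ha : IsCAR a) (Ω : F)
    (hΩ : ∀ h, a h Ω = 0) {n : ℕ} (hΩ1 : ‖Ω‖ = 1) (f g : Fin n → E) :
    ⟪wedge a Ω f, wedge a Ω g⟫_ℂ = (Matrix.of fun i j => ⟪f i, g j⟫_ℂ).det := by
  induction n with
  | zero => simp [wedge_zero, hΩ1, inner_self_eq_norm_sq_to_K]
  | succ n ih =>
    rw [wedge_succ Ω f, ContinuousLinearMap.star_eq_adjoint,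
      ContinuousLinearMap.adjoint_inner_left, ann_wedge ha Ω hΩ, inner_sum,
      Matrix.det_succ_row_zero]
    refine Finset.sum_congr rfl fun j _ => ?_
    rw [inner_smul_right, ih]
    rfl

theorem inner_wedge_of_ne {a : E →ₗ⋆[ℂ] (F →L[ℂ] F)} (ha : IsCAR a) (Ω : F)
    (hΩ : ∀ h, a h Ω = 0) {n m : ℕ} (hnm : n ≠ m) (f : Fin n → E) (g : Fin m → E) :
    ⟪wedge a Ω f, wedge a Ω g⟫_ℂ = 0 := by
  induction n generalizing m with
  | zero =>
    obtain ⟨m, rfl⟩ := Nat.exists_eq_succ_of_ne_zero hnm.symm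
    rw [wedge_zero, wedge_succ, ContinuousLinearMap.star_eq_adjoint,
      ContinuousLinearMap.adjoint_inner_right, hΩ, inner_zero_left]
  | succ n ih =>
    rw [wedge_succ Ω f, ContinuousLinearMap.star_eq_adjoint,
      ContinuousLinearMap.adjoint_inner_left]
    cases m with
    | zero => rw [wedge_zero, hΩ, inner_zero_right]
    | succ m =>
      rw [ann_wedge ha Ω hΩ, inner_sum]
      refine Finset.sum_eq_zero fun j _ => ?_
      rw [inner_smul_right, ih (by omega), mul_zero]
end Gram

section Quasi
variable {H : Type*} [NormedAddCommGroup H] [InnerProductSpace ℂ H]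
  {F : Type*} [NormedAddCommGroup F] [InnerProductSpace ℂ F] [CompleteSpace F]

/-- `h ↦ a(S h ⊕ 0) + a*(0 ⊕ C T h)`, with `C` a conjugation. -/
def doubled (a : WithLp 2 (H × H) →ₗ⋆[ℂ] (F →L[ℂ] F)) (S T : H →L[ℂ] H) (C : H →ₗ⋆[ℂ] H) : H →ₗ⋆[ℂ] (F →L[ℂ] F) where
  toFun h := a (WithLp.toLp 2 (S h, 0)) + star (a (WithLp.toLp 2 (0, C (T h))))
  map_add' h k := by
    have h1 : WithLp.toLp 2 (S (h + k), (0 : H)) =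
      WithLp.toLp 2 (S h, 0) + WithLp.toLp 2 (S k, 0) := by
      rw [← WithLp.toLp_add]; simp
    have h2 : WithLp.toLp 2 ((0 : H), C (T (h + k))) =
      WithLp.toLp 2 (0, C (T h)) + WithLp.toLp 2 (0, C (T k)) := by
      rw [← WithLp.toLp_add]; simp
    rw [h1, h2, map_add, map_add, star_add]; abel
  map_smul' c h := by
    have h1 : WithLp.toLp 2 (S (c • h), (0 : H)) = c • WithLp.toLp 2 (S h, 0) := by
      rw [← WithLp.toLp_smul]; simp
    have h2 : WithLp.toLp 2 ((0 : H), C (T (c • h))) =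
      (starRingEnd ℂ) c • WithLp.toLp 2 (0, C (T h)) := by
      rw [← WithLp.toLp_smul]; simp
    rw [h1, h2, map_smulₛₗ, map_smulₛₗ, star_smul, smul_add]; simp

theorem isCAR_doubled {a : WithLp 2 (H × H) →ₗ⋆[ℂ] (F →L[ℂ] F)} (ha : IsCAR a) {S T : H →L[ℂ] H} {C : H →ₗ⋆[ℂ] H}
    (hC : ∀ x y, ⟪C x, C y⟫_ℂ = ⟪y, x⟫_ℂ)
    (hST : ∀ x y, ⟪S x, S y⟫_ℂ + ⟪T x, T y⟫_ℂ = ⟪x, y⟫_ℂ) : IsCAR (doubled a S T C) where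
  anticomm h k := by
    have h1 := ha.anticomm (WithLp.toLp 2 (S h, 0)) (WithLp.toLp 2 (S k, 0))
    have h2 := congrArg star
      (ha.anticomm (WithLp.toLp 2 (0, C (T k))) (WithLp.toLp 2 (0, C (T h))))
    have h3 := ha.anticomm_star (WithLp.toLp 2 (0, C (T k))) (WithLp.toLp 2 (S h, 0))
    have h4 := ha.anticomm_star (WithLp.toLp 2 (0, C (T h))) (WithLp.toLp 2 (S k, 0))
    simp only [WithLp.prod_inner_apply, inner_zero_left, inner_zero_right, add_zero, map_zero] at h3 h4
    simp only [star_add, star_mul, star_zero] at h2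
    simp only [doubled, LinearMap.coe_mk, AddHom.coe_mk, add_mul, mul_add]
    linear_combination (norm := abel) h1 + h2 + h3 + h4
  anticomm_star h k := by
    have h1 := ha.anticomm_star (WithLp.toLp 2 (S h, 0)) (WithLp.toLp 2 (S k, 0))
    have h2 := ha.anticomm_star (WithLp.toLp 2 (0, C (T k))) (WithLp.toLp 2 (0, C (T h)))
    have h3 := congrArg star (ha.anticomm (WithLp.toLp 2 (S h, 0)) (WithLp.toLp 2 (0, C (T k))))
    have h4 := ha.anticomm (WithLp.toLp 2 (0, C (T h))) (WithLp.toLp 2 (S k, 0))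
    have h5 := congrArg (algebraMap ℂ (F →L[ℂ] F)) (hST k h)
    simp only [WithLp.prod_inner_apply, inner_zero_right, add_zero, zero_add, hC] at h1 h2
    rw [map_add] at h5
    simp only [star_add, star_mul, star_zero] at h3
    simp only [doubled, LinearMap.coe_mk, AddHom.coe_mk, add_mul, mul_add, star_add, star_star]
    linear_combination (norm := abel) h1 + h2 + h3 + h4 + h5

theorem doubled_prod_vac {a : WithLp 2 (H × H) →ₗ⋆[ℂ] (F →L[ℂ] F)} (ha : IsCAR a) {S T : H →L[ℂ] H} {C : H →ₗ⋆[ℂ] H} (Ω : F)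
    (hΩ : ∀ h, a h Ω = 0) {n : ℕ} (k : Fin n → H) :
    (List.ofFn fun i => doubled a S T C (k i)).prod Ω =
      wedge a Ω fun i => WithLp.toLp 2 (0, C (T (k i))) := by
  induction n with
  | zero => simp [wedge_zero]
  | succ n ih =>
    rw [List.ofFn_succ, List.prod_cons, wedge_succ]
    change doubled a S T C (k 0) ((List.ofFn fun i => doubled a S T C (k i.succ)).prod Ω) = _
    rw [ih fun i => k i.succ]
    have h0 : a (WithLp.toLp 2 (S (k 0), 0))
        (wedge a Ω fun i : Fin n => WithLp.toLp 2 (0, C (T (k i.succ)))) = 0 := by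
      cases n with
      | zero => rw [wedge_zero, hΩ]
      | succ n =>
        rw [ann_wedge ha Ω hΩ]
        refine Finset.sum_eq_zero fun j _ => ?_
        simp [WithLp.prod_inner_apply]
    simp only [doubled, LinearMap.coe_mk, AddHom.coe_mk, add_apply, h0, zero_add]

theorem exists_conj (H : Type*) [NormedAddCommGroup H] [InnerProductSpace ℂ H] [CompleteSpace H] :
    ∃ C : H →ₗ⋆[ℂ] H, ∀ x y, ⟪C x, C y⟫_ℂ = ⟪y, x⟫_ℂ := by
  obtain ⟨w, b, -⟩ := exists_hilbertBasis ℂ H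
  refine ⟨⟨⟨fun x => b.repr.symm (star (b.repr x)), fun x y => by simp⟩, fun c x => by simp⟩, ?_⟩
  intro x y
  change ⟪b.repr.symm (star (b.repr x)), b.repr.symm (star (b.repr y))⟫_ℂ = _
  rw [b.repr.symm.inner_map_map, ← b.repr.inner_map_map y x, lp.inner_eq_tsum, lp.inner_eq_tsum]
  refine tsum_congr fun i => ?_
  simp [mul_comm]
end Quasi

end Fock

/-! ### Quasi-free states -/

section QuasiFree
variable {H : Type u} [NormedAddCommGroup H] [InnerProductSpace ℂ H]

open CARAlgebra in
/-- `φ` is a quasi-free state on the CAR algebra with `φ(a*(h) a(k)) = ⟨K h, k⟩`. Note that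
`a*(hₙ) ⋯ a*(h₁)` is the adjoint of `a(h₁) ⋯ a(hₙ)`. -/
structure IsQuasiFreeState (K : H →L[ℂ] H) (φ : CARAlgebra H →ₚ[ℂ] ℂ) : Prop where
  map_one : φ 1 = 1
  map_monomial : ∀ (n : ℕ) (h k : Fin n → H),
    φ (star (List.ofFn fun i => a (h i)).prod * (List.ofFn fun i => a (k i)).prod) =
      (Matrix.of fun i j => φ (star (a (h i)) * a (k j))).det
  map_monomial_of_ne : ∀ (n m : ℕ) (h : Fin n → H) (k : Fin m → H), n ≠ m →
    φ (star (List.ofFn fun i => a (h i)).prod * (List.ofFn fun i => a (k i)).prod) = 0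
  two_point : ∀ h k : H, φ (star (a h) * a k) = ⟪k, K h⟫_ℂ

theorem inner_star_mul {F : Type*} [NormedAddCommGroup F] [InnerProductSpace ℂ F]
    [CompleteSpace F] (ρ : CARAlgebra H →⋆ₐ[ℂ] (F →L[ℂ] F)) (Ω : F) (x y : CARAlgebra H) :
    ⟪Ω, ρ (star x * y) Ω⟫_ℂ = ⟪ρ x Ω, ρ y Ω⟫_ℂ := by
  have h : ρ (star x * y) = ContinuousLinearMap.adjoint (ρ x) * ρ y := by
    rw [map_mul, map_star, ContinuousLinearMap.star_eq_adjoint]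
  rw [h]
  exact ContinuousLinearMap.adjoint_inner_right (ρ x) Ω (ρ y Ω)

/-- The functional `x ↦ ⟨ρ(x) Ω, Ω⟩`. -/
def vectorFunctional {F : Type*} [NormedAddCommGroup F] [InnerProductSpace ℂ F] [CompleteSpace F]
    (ρ : CARAlgebra H →⋆ₐ[ℂ] (F →L[ℂ] F)) (Ω : F) : CARAlgebra H →ₚ[ℂ] ℂ :=
  PositiveLinearMap.mk₀
    { toFun := fun x => ⟪Ω, ρ x Ω⟫_ℂ
      map_add' := fun x y => by rw [map_add, ← inner_add_right]; rfl
      map_smul' := fun c x => by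
        rw [map_smul, RingHom.id_apply, smul_eq_mul, ← inner_smul_right]; rfl } (fun x hx => by
    obtain ⟨y, rfl⟩ := CStarAlgebra.nonneg_iff_eq_star_mul_self.1 hx
    change 0 ≤ ⟪Ω, ρ (star y * y) Ω⟫_ℂ
    rw [inner_star_mul, inner_self_eq_norm_sq_to_K, ← RCLike.ofReal_pow]
    exact RCLike.ofReal_nonneg.2 (sq_nonneg ‖ρ y Ω‖))

theorem vectorFunctional_star_mul {F : Type*} [NormedAddCommGroup F] [InnerProductSpace ℂ F]
    [CompleteSpace F] (ρ : CARAlgebra H →⋆ₐ[ℂ] (F →L[ℂ] F)) (Ω : F) (x y : CARAlgebra H) :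
    vectorFunctional ρ Ω (star x * y) = ⟪ρ x Ω, ρ y Ω⟫_ℂ :=
  inner_star_mul ρ Ω x y

open CARAlgebra in
theorem exists_isQuasiFreeState [CompleteSpace H] (K : H →L[ℂ] H) (hK₀ : 0 ≤ K) (hK₁ : K ≤ 1) :
    ∃ φ : CARAlgebra H →ₚ[ℂ] ℂ, IsQuasiFreeState K φ := by
  obtain ⟨w, b, -⟩ := exists_hilbertBasis ℂ (WithLp 2 (H × H))
  obtain ⟨C, hC⟩ := Fock.exists_conj H
  classical
  let _ : LinearOrder w := linearOrderOfSTO WellOrderingRel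
  let S : H →L[ℂ] H := CFC.sqrt (1 - K)
  let T : H →L[ℂ] H := CFC.sqrt K
  have hS : ∀ x y, ⟪S x, S y⟫_ℂ = ⟪x, (1 - K) y⟫_ℂ := fun x y => by
    have h1 : IsSelfAdjoint S := .of_nonneg (CFC.sqrt_nonneg _)
    have h2 : S * S = 1 - K := CFC.sqrt_mul_sqrt_self _ (sub_nonneg.2 hK₁)
    rw [← h2, ← ContinuousLinearMap.adjoint_inner_right, h1.adjoint_eq]
    rfl
  have hT : ∀ x y, ⟪T x, T y⟫_ℂ = ⟪x, K y⟫_ℂ := fun x y => by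
    have h1 : IsSelfAdjoint T := .of_nonneg (CFC.sqrt_nonneg _)
    have h2 : T * T = K := CFC.sqrt_mul_sqrt_self _ hK₀
    rw [← ContinuousLinearMap.adjoint_inner_right, h1.adjoint_eq]
    exact congrArg (fun R : H →L[ℂ] H => ⟪x, R y⟫_ℂ) h2
  have hST : ∀ x y, ⟪S x, S y⟫_ℂ + ⟪T x, T y⟫_ℂ = ⟪x, y⟫_ℂ := fun x y => by
    rw [hS, hT, ← inner_add_right]; simp
  let Ω : Fock.Space w := Fock.vac
  have hΩ1 : ‖Ω‖ = 1 := by simp [Ω, Fock.vac, lp.norm_single]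
  have hnt : Nontrivial (Fock.Space w) :=
    ⟨Ω, 0, fun h => by rw [h, norm_zero] at hΩ1; exact zero_ne_one hΩ1⟩
  have hΩ : ∀ h, Fock.a b h Ω = 0 := Fock.a_vac b
  obtain ⟨ρ, hρ⟩ := exists_lift (Fock.isCAR_doubled (Fock.isCAR_a b) hC hST)
  let φ : CARAlgebra H →ₚ[ℂ] ℂ := vectorFunctional ρ Ω
  have hφ : ∀ x y : CARAlgebra H, φ (star x * y) = ⟪ρ x Ω, ρ y Ω⟫_ℂ :=
    vectorFunctional_star_mul ρ Ω
  have hprod : ∀ (n : ℕ) (k : Fin n → H), ρ (List.ofFn fun i => a (k i)).prod Ω =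
      Fock.wedge (Fock.a b) Ω fun i => WithLp.toLp 2 (0, C (T (k i))) := fun n k => by
    rw [← Fock.doubled_prod_vac (S := S) (Fock.isCAR_a b) Ω hΩ k, map_list_prod, List.map_ofFn]
    simp only [Function.comp_def, hρ]
  have hinner : ∀ h k : H, ⟪WithLp.toLp 2 ((0 : H), C (T h)), WithLp.toLp 2 ((0 : H), C (T k))⟫_ℂ =
      ⟪k, K h⟫_ℂ := fun h k => by
    rw [WithLp.prod_inner_apply, hC, hT]; simp
  have htwo : ∀ h k : H, φ (star (a h) * a k) = ⟪k, K h⟫_ℂ := fun h k => by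
    have h1 := hprod 1 fun _ => h
    have h2 := hprod 1 fun _ => k
    simp only [List.ofFn_succ, List.ofFn_zero, List.prod_cons, List.prod_nil, mul_one] at h1 h2
    rw [hφ, h1, h2, Fock.inner_wedge (Fock.isCAR_a b) Ω hΩ hΩ1, Matrix.det_fin_one]
    exact hinner h k
  refine ⟨φ, ?_, fun n h k => ?_, fun n m h k hnm => ?_, htwo⟩
  · have := hφ 1 1
    rw [star_one, one_mul] at this
    rw [this, _root_.map_one ρ]
    change ⟪Ω, Ω⟫_ℂ = 1
    rw [inner_self_eq_norm_sq_to_K, hΩ1]; simp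
  · rw [hφ, hprod, hprod, Fock.inner_wedge (Fock.isCAR_a b) Ω hΩ hΩ1]
    simp only [hinner, htwo]
  · rw [hφ, hprod, hprod, Fock.inner_wedge_of_ne (Fock.isCAR_a b) Ω hΩ hnm]

/-- The quasi-free state `φ_K` associated with a positive contraction `K`. -/
def quasiFreeState [CompleteSpace H] (K : H →L[ℂ] H) (hK₀ : 0 ≤ K) (hK₁ : K ≤ 1) :
    CARAlgebra H →ₚ[ℂ] ℂ :=
  Classical.choose (exists_isQuasiFreeState K hK₀ hK₁)

theorem isQuasiFreeState_quasiFreeState [CompleteSpace H] (K : H →L[ℂ] H) (hK₀ : 0 ≤ K)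
    (hK₁ : K ≤ 1) : IsQuasiFreeState K (quasiFreeState K hK₀ hK₁) :=
  Classical.choose_spec (exists_isQuasiFreeState K hK₀ hK₁)

/-- The restriction of a positive functional to the GICAR algebra. -/
def restrictGICAR (φ : CARAlgebra H →ₚ[ℂ] ℂ) : GICAR H →ₚ[ℂ] ℂ :=
  PositiveLinearMap.mk₀ (φ.toLinearMap ∘ₗ (GICAR.incl (H := H)).toLinearMap) fun x hx => by
    obtain ⟨y, rfl⟩ := CStarAlgebra.nonneg_iff_eq_star_mul_self.1 hx
    change 0 ≤ φ (GICAR.incl (star y * y))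
    rw [map_mul, map_star]
    exact φ.map_nonneg (star_mul_self_nonneg _)

end QuasiFree

/-! ### One-parameter unitary groups and their generators -/

/-- Strongly continuous one-parameter groups of unitary operators. -/
@[ext]
structure UnitaryGroup (E : Type*) [NormedAddCommGroup E] [InnerProductSpace ℂ E] where
  toFun : ℝ → (E ≃ₗᵢ[ℂ] E)
  map_zero : toFun 0 = 1
  map_add : ∀ s t, toFun (s + t) = toFun s * toFun t
  continuous : ∀ x, Continuous fun t => toFun t x

namespace UnitaryGroup
variable {E : Type*} [NormedAddCommGroup E] [InnerProductSpace ℂ E]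

/-- The pairs `(x, y)` with `y = lim (U_t x - x) / (i t)` as `t → 0`. -/
def generatorGraph (U : UnitaryGroup E) : Submodule ℂ (E × E) where
  carrier := {p | Filter.Tendsto (fun t : ℝ => (Complex.I * t)⁻¹ • (U.toFun t p.1 - p.1))
    (nhdsWithin 0 {0}ᶜ) (nhds p.2)}
  zero_mem' := by simp
  add_mem' {p q} hp hq := by
    refine (Filter.Tendsto.add hp hq).congr fun t => ?_
    rw [← smul_add, Prod.fst_add, LinearIsometryEquiv.map_add]
    congr 1
    abel
  smul_mem' c p hp := by
    refine (Filter.Tendsto.const_smul hp c).congr fun t => ?_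
    rw [smul_comm, smul_sub, Prod.smul_fst, LinearIsometryEquiv.map_smul]

/-- The infinitesimal generator: the operator `G` with `U_t = exp(i t G)`. Limits being unique,
`generatorGraph` is the graph of an operator. -/
def generator (U : UnitaryGroup E) : E →ₗ.[ℂ] E := U.generatorGraph.toLinearPMap

theorem generator_graph (U : UnitaryGroup E) : U.generator.graph = U.generatorGraph := by
  refine Submodule.toLinearPMap_graph_eq _ fun p hp h0 => ?_
  have h1 : Filter.Tendsto (fun t : ℝ => (Complex.I * t)⁻¹ • (U.toFun t p.1 - p.1))
    (nhdsWithin 0 {0}ᶜ) (nhds p.2) := hp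
  simp only [h0, LinearIsometryEquiv.map_zero, sub_zero, smul_zero] at h1
  exact tendsto_nhds_unique h1 tendsto_const_nhds

end UnitaryGroup

/-! ### Second quantization in the GNS representation -/

section GNS
variable {H : Type u} [NormedAddCommGroup H] [InnerProductSpace ℂ H]

/-- The GNS cyclic vector. -/
def gnsVector (ψ : GICAR H →ₚ[ℂ] ℂ) : ψ.GNS := ((ψ.toPreGNS 1 : ψ.PreGNS) : ψ.GNS)

/-- `V` is the second quantization of `U` on the GNS space of `ψ`, that is,
`V_t ρ(x) Ω = ρ(γ_{U_t}(x)) Ω` for all `x` in the GICAR algebra. -/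
def IsSecondQuantization (ψ : GICAR H →ₚ[ℂ] ℂ) (U : UnitaryGroup H) (V : UnitaryGroup ψ.GNS) :
    Prop :=
  ∀ (t : ℝ) (x : GICAR H), V.toFun t (ψ.gnsStarAlgHom x (gnsVector ψ)) =
    ψ.gnsStarAlgHom (GICAR.bogoliubov (U.toFun t) x) (gnsVector ψ)

variable {ι : Type*}

/-- The linear span of the vectors `ρ(a*(v_{α₁}) ⋯ a*(v_{αₙ}) a(v_{β₁}) ⋯ a(v_{βₙ})) Ω`, where
`n ≥ 0`, the `αᵢ` are outside of `I₀` and the `βᵢ` are in `I₀`. -/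
def excitationSpan (ψ : GICAR H →ₚ[ℂ] ℂ) (v : ι → H) (I₀ : Set ι) : Submodule ℂ ψ.GNS :=
  Submodule.span ℂ {ξ | ∃ (n : ℕ) (α β : Fin n → ι), (∀ i, α i ∉ I₀) ∧ (∀ i, β i ∈ I₀) ∧
    ξ = ψ.gnsStarAlgHom (GICAR.monomial (fun i => v (α i)) fun i => v (β i)) (gnsVector ψ)}

/-- The pairs `(ξ, η)` with `ξ` in the span of the excitation vectors and
`η = ∑_{α ∉ I₀} m_α ρ(a*(v_α) a(v_α)) ξ - ∑_{α ∈ I₀} m_α ρ(a(v_α) a*(v_α)) ξ`, where both series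
converge. -/
def hamiltonianGraph (ψ : GICAR H →ₚ[ℂ] ℂ) (v : ι → H) (m : ι → ℝ) (I₀ : Set ι) :
    Submodule ℂ (ψ.GNS × ψ.GNS) where
  carrier := {p | p.1 ∈ excitationSpan ψ v I₀ ∧ ∃ y z : ψ.GNS,
    HasSum (fun α : ↥(I₀ᶜ) => (m α : ℂ) • ψ.gnsStarAlgHom (GICAR.creAnn (v α) (v α)) p.1) y ∧
    HasSum (fun α : ↥I₀ => (m α : ℂ) • ψ.gnsStarAlgHom (GICAR.annCre (v α) (v α)) p.1) z ∧
    p.2 = y - z}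
  zero_mem' := ⟨zero_mem _, 0, 0, by simp, by simp, by simp⟩
  add_mem' := by
    rintro p q ⟨hp, y, z, hy, hz, h⟩ ⟨hq, y', z', hy', hz', h'⟩
    refine ⟨add_mem hp hq, y + y', z + z', ?_, ?_, ?_⟩
    · simpa only [Prod.fst_add, map_add, smul_add] using hy.add hy'
    · simpa only [Prod.fst_add, map_add, smul_add] using hz.add hz'
    · rw [Prod.snd_add, h, h']; abel
  smul_mem' := by
    rintro c p ⟨hp, y, z, hy, hz, h⟩
    refine ⟨Submodule.smul_mem _ c hp, c • y, c • z, ?_, ?_, ?_⟩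
    · simpa only [Prod.smul_fst, map_smul, smul_comm c] using hy.const_smul c
    · simpa only [Prod.smul_fst, map_smul, smul_comm c] using hz.const_smul c
    · rw [Prod.smul_snd, h, smul_sub]

/-- The operator
`∑_{α ∉ I₀} m_α ρ(a*(v_α) a(v_α)) - ∑_{α ∈ I₀} m_α ρ(a(v_α) a*(v_α))` on the span of the
excitation vectors. Sums being unique, `hamiltonianGraph` is the graph of an operator. -/
def hamiltonian (ψ : GICAR H →ₚ[ℂ] ℂ) (v : ι → H) (m : ι → ℝ) (I₀ : Set ι) :
    ψ.GNS →ₗ.[ℂ] ψ.GNS :=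
  (hamiltonianGraph ψ v m I₀).toLinearPMap

theorem hamiltonian_graph (ψ : GICAR H →ₚ[ℂ] ℂ) (v : ι → H) (m : ι → ℝ) (I₀ : Set ι) :
    (hamiltonian ψ v m I₀).graph = hamiltonianGraph ψ v m I₀ := by
  refine Submodule.toLinearPMap_graph_eq _ ?_
  rintro p ⟨-, y, z, hy, hz, h⟩ h0
  simp only [h0, map_zero, smul_zero] at hy hz
  rw [h, hy.unique hasSum_zero, hz.unique hasSum_zero, sub_zero]

/-- The orthogonal projection onto the closed linear span of `{v_α : α ∈ I₀}`. -/
def spanProjection [CompleteSpace H] (v : ι → H) (I₀ : Set ι) : H →L[ℂ] H :=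
  (Submodule.span ℂ (v '' I₀)).topologicalClosure.starProjection

theorem spanProjection_nonneg [CompleteSpace H] (v : ι → H) (I₀ : Set ι) :
    0 ≤ spanProjection v I₀ :=
  isStarProjection_starProjection.nonneg

theorem spanProjection_le_one [CompleteSpace H] (v : ι → H) (I₀ : Set ι) :
    spanProjection v I₀ ≤ 1 :=
  isStarProjection_starProjection.le_one

/-- The restriction to the GICAR algebra of the quasi-free state `φ_K`, where `K` is the orthogonal
projection onto the closed linear span of `{v_α : α ∈ I₀}`. -/
def projectionState [CompleteSpace H] (v : ι → H) (I₀ : Set ι) : GICAR H →ₚ[ℂ] ℂ :=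
  restrictGICAR (quasiFreeState (spanProjection v I₀) (spanProjection_nonneg v I₀)
    (spanProjection_le_one v I₀))

end GNS

end

/-!
Filling the modes in `I₀` turns `φ_K` into a vacuum: the operators `b α = a(v α)` for `α ∉ I₀` and
`b α = a(v α)*` for `α ∈ I₀` again satisfy the canonical anticommutation relations, and
`φ_K (b α* b α) = 0`. Normal ordering therefore shows that the words in the `b α*` generate the
Fock representation, and gauge invariance kills every word of nonzero charge, so that the
`v_{α₁,…,αₙ;β₁,…,βₙ}` are total in the GNS space of the GICAR algebra. They are joint eigenvectors
of the number operators `b α* b α`, hence of the series defining `𝒜`, and at the same time of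
`Γ_K(U_t)`, with matching eigenvalues. What remains is a general fact: a closed symmetric operator
with a total family of eigenvectors is the closure of its restriction to their span.
-/

noncomputable section

section Total
variable {E F : Type*} [NormedAddCommGroup E] [NormedSpace ℂ E] [NormedAddCommGroup F]
  [NormedSpace ℂ F] {κ : Type*} {e : κ → E}

theorem isometry_eq_of_eqOn_total {S T : E →ₗᵢ[ℂ] F}
    (he : Dense (Submodule.span ℂ (Set.range e) : Set E)) (h : ∀ i, S (e i) = T (e i)) : S = T :=
  LinearIsometry.toContinuousLinearMap_injective <|
    ContinuousLinearMap.ext_on he (Set.forall_mem_range.2 h)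

theorem continuous_apply_of_total {X : Type*} [TopologicalSpace X] {T : X → E →ₗᵢ[ℂ] F}
    (he : Dense (Submodule.span ℂ (Set.range e) : Set E))
    (h : ∀ i, Continuous fun t => T t (e i)) (x : E) : Continuous fun t => T t x := by
  have hspan : ∀ y ∈ Submodule.span ℂ (Set.range e), Continuous fun t => T t y := fun y hy => by
    induction hy using Submodule.span_induction with
    | mem y hy => obtain ⟨i, rfl⟩ := hy; exact h i
    | zero => simp only [LinearIsometry.map_zero]; exact continuous_const
    | add y z _ _ hy hz => simp only [LinearIsometry.map_add]; exact hy.add hz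
    | smul c y _ hy => simp only [map_smul]; exact hy.const_smul c
  have hjoint : Continuous fun p : E × X => T p.2 p.1 :=
    continuous_prod_of_dense_continuous_lipschitzWith _ 1 he hspan fun t => (T t).lipschitz
  exact hjoint.comp (Continuous.prodMk_right x)

theorem hasDerivAt_exp_smul (μ : ℝ) (x : E) (s : ℝ) :
    HasDerivAt (fun t : ℝ => Complex.exp (Complex.I * t * μ) • x)
      (Complex.I • (μ : ℂ) • Complex.exp (Complex.I * s * μ) • x) s := by
  have hexp : HasDerivAt (fun t : ℝ => Complex.I * t * μ) (Complex.I * μ) s := by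
    simpa using ((Complex.ofRealCLM.hasDerivAt (x := s)).const_mul Complex.I).mul_const (μ : ℂ)
  convert hexp.cexp.smul_const x using 1
  rw [smul_smul, smul_smul, mul_comm]

end Total

section Eigenvectors
variable {E : Type*} [NormedAddCommGroup E] [InnerProductSpace ℂ E] {κ : Type*}
  {e : κ → E} {μ : κ → ℝ}

/-- The graph of the operator on the linear span of the `e i` (when there is one) whose eigenvectors
are the `e i`, with eigenvalues `μ i`. It is a submodule so that it makes sense for every family. -/
def eigenGraph (e : κ → E) (μ : κ → ℝ) : Submodule ℂ (E × E) :=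
  Submodule.span ℂ (Set.range fun i => (e i, (μ i : ℂ) • e i))

theorem eigenGraph_le_iff {g : Submodule ℂ (E × E)} :
    eigenGraph e μ ≤ g ↔ ∀ i, (e i, (μ i : ℂ) • e i) ∈ g := by
  rw [eigenGraph, Submodule.span_le, Set.range_subset_iff]
  rfl

theorem map_fst_eigenGraph :
    (eigenGraph e μ).map (LinearMap.fst ℂ E E) = Submodule.span ℂ (Set.range e) := by
  rw [eigenGraph, Submodule.map_span, ← Set.range_comp]
  rfl

theorem graph_eq_eigenGraph {T : E →ₗ.[ℂ] E} (hdom : T.domain ≤ Submodule.span ℂ (Set.range e))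
    (hmem : ∀ i, (e i, (μ i : ℂ) • e i) ∈ T.graph) : T.graph = eigenGraph e μ := by
  have hle : eigenGraph e μ ≤ T.graph := eigenGraph_le_iff.2 hmem
  refine le_antisymm (fun p hp => ?_) hle
  obtain ⟨q, hq, hqp⟩ : p.1 ∈ (eigenGraph e μ).map (LinearMap.fst ℂ E E) :=
    map_fst_eigenGraph.ge (hdom (T.mem_domain_of_mem_graph hp))
  rwa [← Prod.ext hqp (T.mem_graph_snd_inj' (hle hq) hp hqp)]

theorem norm_le_norm_snd_add_I_smul_fst {p : E × E} (hp : ⟪p.2, p.1⟫_ℂ = ⟪p.1, p.2⟫_ℂ) :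
    ‖p‖ ≤ ‖p.2 + Complex.I • p.1‖ := by
  have hreal : (⟪p.2, p.1⟫_ℂ).im = 0 :=
    Complex.conj_eq_iff_im.1 ((inner_conj_symm (𝕜 := ℂ) p.1 p.2).trans hp.symm)
  have hpyth : ‖p.2 + Complex.I • p.1‖ ^ 2 = ‖p.2‖ ^ 2 + ‖p.1‖ ^ 2 := by
    simp [norm_add_sq (𝕜 := ℂ), norm_smul, hreal]
  refine max_le ?_ ?_ <;> refine le_of_sq_le_sq ?_ (norm_nonneg _) <;> rw [hpyth]
  · exact le_add_of_nonneg_left (sq_nonneg _)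
  · exact le_add_of_nonneg_right (sq_nonneg _)

theorem eq_topologicalClosure_eigenGraph {g : Submodule ℂ (E × E)} (hg : IsClosed (g : Set (E × E)))
    (hsym : ∀ p ∈ g, ∀ q ∈ g, ⟪p.2, q.1⟫_ℂ = ⟪p.1, q.2⟫_ℂ)
    (he : Dense (Submodule.span ℂ (Set.range e) : Set E))
    (hmem : ∀ i, (e i, (μ i : ℂ) • e i) ∈ g) : g = (eigenGraph e μ).topologicalClosure := by
  have hle : eigenGraph e μ ≤ g := eigenGraph_le_iff.2 hmem
  refine le_antisymm (fun p hp => ?_) (Submodule.topologicalClosure_minimal _ hle hg)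
  -- `T (x, y) = y + i x` is expansive on `g` and maps `eigenGraph e μ` onto the span of the `e i`.
  let T : E × E →ₗ[ℂ] E := LinearMap.snd ℂ E E + Complex.I • LinearMap.fst ℂ E E
  have hrange : Submodule.span ℂ (Set.range e) ≤ (eigenGraph e μ).map T := by
    refine Submodule.span_le.2 (Set.range_subset_iff.2 fun i => ?_)
    have hμ : (μ i : ℂ) + Complex.I ≠ 0 := fun h => by simpa using congrArg Complex.im h
    refine ⟨((μ i : ℂ) + Complex.I)⁻¹ • (e i, (μ i : ℂ) • e i),
      Submodule.smul_mem _ _ (Submodule.subset_span ⟨i, rfl⟩), ?_⟩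
    rw [map_smul]
    change _ • ((μ i : ℂ) • e i + Complex.I • e i) = e i
    rw [← add_smul, inv_smul_smul₀ hμ]
  refine Metric.mem_closure_iff.2 fun ε hε => ?_
  obtain ⟨y, hy, hlt⟩ := Metric.mem_closure_iff.1 (he (T p)) ε hε
  obtain ⟨q, hq, rfl⟩ := hrange hy
  have hpq := sub_mem hp (hle hq)
  rw [dist_eq_norm, ← map_sub] at hlt
  refine ⟨q, hq, ?_⟩
  rw [dist_eq_norm]
  exact (norm_le_norm_snd_add_I_smul_fst (hsym _ hpq _ hpq)).trans_lt hlt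

end Eigenvectors

namespace UnitaryGroup
variable {E : Type*} [NormedAddCommGroup E] [InnerProductSpace ℂ E]

theorem apply_zero (U : UnitaryGroup E) (x : E) : U.toFun 0 x = x := by rw [U.map_zero]; rfl

theorem apply_add (U : UnitaryGroup E) (s t : ℝ) (x : E) :
    U.toFun (s + t) x = U.toFun s (U.toFun t x) := by rw [U.map_add]; rfl

theorem mem_generatorGraph_iff_hasDerivAt {U : UnitaryGroup E} {p : E × E} :
    p ∈ U.generatorGraph ↔ HasDerivAt (fun t => U.toFun t p.1) (Complex.I • p.2) 0 := by
  have hslope (t : ℝ) : (t : ℝ)⁻¹ • (U.toFun (0 + t) p.1 - U.toFun 0 p.1) =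
      Complex.I • (Complex.I * t)⁻¹ • (U.toFun t p.1 - p.1) := by
    rw [zero_add, U.apply_zero, smul_smul, mul_inv, mul_inv_cancel_left₀ Complex.I_ne_zero,
      ← Complex.ofReal_inv, Complex.coe_smul]
  rw [hasDerivAt_iff_tendsto_slope_zero]
  simp only [hslope]
  exact (tendsto_const_smul_iff₀ Complex.I_ne_zero).symm

theorem hasDerivAt_apply {U : UnitaryGroup E} {p : E × E} (hp : p ∈ U.generatorGraph) (s : ℝ) :
    HasDerivAt (fun t => U.toFun t p.1) (Complex.I • U.toFun s p.2) s := by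
  have hshift : HasDerivAt (fun t => U.toFun (t - s) p.1) (Complex.I • p.2) s :=
    HasDerivAt.comp_sub_const s s (by rw [sub_self]; exact mem_generatorGraph_iff_hasDerivAt.1 hp)
  have hcomp := ((U.toFun s).toLinearIsometry.toContinuousLinearMap.restrictScalars
    ℝ).hasFDerivAt.comp_hasDerivAt s hshift
  convert hcomp using 1
  · funext t
    change U.toFun t p.1 = U.toFun s (U.toFun (t - s) p.1)
    rw [← U.apply_add, add_sub_cancel]
  · exact ((U.toFun s).map_smul _ _).symm

theorem inner_generatorGraph (U : UnitaryGroup E) {p q : E × E} (hp : p ∈ U.generatorGraph)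
    (hq : q ∈ U.generatorGraph) : ⟪p.2, q.1⟫_ℂ = ⟪p.1, q.2⟫_ℂ := by
  have hderiv := (mem_generatorGraph_iff_hasDerivAt.1 hp).inner ℂ
    (mem_generatorGraph_iff_hasDerivAt.1 hq)
  simp only [LinearIsometryEquiv.inner_map_map, U.apply_zero, inner_smul_left, inner_smul_right,
    Complex.conj_I] at hderiv
  have hzero := hderiv.unique (hasDerivAt_const _ _)
  refine mul_left_cancel₀ Complex.I_ne_zero ?_
  linear_combination -hzero

theorem mem_generatorGraph_iff_integral [CompleteSpace E] {U : UnitaryGroup E} {p : E × E} :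
    p ∈ U.generatorGraph ↔
      ∀ t, U.toFun t p.1 - p.1 = ∫ s in (0 : ℝ)..t, Complex.I • U.toFun s p.2 := by
  have hcont : Continuous fun s => Complex.I • U.toFun s p.2 := (U.continuous p.2).const_smul _
  constructor
  · intro hp t
    rw [intervalIntegral.integral_eq_sub_of_hasDerivAt (fun s _ => hasDerivAt_apply hp s)
      (hcont.intervalIntegrable 0 t), U.apply_zero]
  · intro h
    have hderiv := (hcont.integral_hasStrictDerivAt 0 0).hasDerivAt.const_add p.1
    rw [U.apply_zero] at hderiv
    refine mem_generatorGraph_iff_hasDerivAt.2 (hderiv.congr_of_eventuallyEq ?_)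
    exact .of_forall fun t => (add_eq_of_eq_sub' (h t).symm).symm

theorem continuous_uncurry_apply (U : UnitaryGroup E) :
    Continuous fun p : E × ℝ => U.toFun p.2 p.1 :=
  continuous_prod_of_continuous_lipschitzWith _ 1 U.continuous fun t => (U.toFun t).lipschitz

theorem isClosed_generatorGraph [CompleteSpace E] (U : UnitaryGroup E) :
    IsClosed (U.generatorGraph : Set (E × E)) := by
  have hset : (U.generatorGraph : Set (E × E)) =
      ⋂ t, {p | U.toFun t p.1 - p.1 = ∫ s in (0 : ℝ)..t, Complex.I • U.toFun s p.2} := by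
    ext p
    rw [Set.mem_iInter]
    exact mem_generatorGraph_iff_integral
  rw [hset]
  refine isClosed_iInter fun t => isClosed_eq (by fun_prop) ?_
  have hU : Continuous fun q : (E × E) × ℝ => U.toFun q.2 q.1.2 :=
    U.continuous_uncurry_apply.comp (g := fun p : E × ℝ => U.toFun p.2 p.1)
      (f := fun q : (E × E) × ℝ => (q.1.2, q.2)) (by fun_prop)
  exact intervalIntegral.continuous_parametric_intervalIntegral_of_continuous'
    (hU.const_smul Complex.I) 0 t

theorem apply_eq_exp_smul_iff {U : UnitaryGroup E} {x : E} {μ : ℝ} :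
    (∀ t : ℝ, U.toFun t x = Complex.exp (Complex.I * t * μ) • x) ↔
      (x, (μ : ℂ) • x) ∈ U.generatorGraph := by
  constructor
  · intro h
    rw [mem_generatorGraph_iff_hasDerivAt]
    simpa [h] using hasDerivAt_exp_smul μ x 0
  · intro h t
    refine congrFun (ODE_solution_unique_univ (f := fun t => U.toFun t x)
      (v := fun _ y => Complex.I • (μ : ℂ) • y)
      (s := fun _ => Set.univ) (t₀ := 0)
      (fun t => ((lipschitzWith_smul Complex.I).comp (lipschitzWith_smul (μ : ℂ))).lipschitzOnWith)
      (fun s => ⟨?_, trivial⟩) (fun s => ⟨hasDerivAt_exp_smul μ x s, trivial⟩) ?_) t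
    · simpa only [map_smul] using hasDerivAt_apply h s
    · simp [U.apply_zero]

variable {κ : Type*} {e : κ → E} {μ : κ → ℝ}

theorem eq_of_apply_eq {U V : UnitaryGroup E}
    (he : Dense (Submodule.span ℂ (Set.range e) : Set E))
    (h : ∀ (t : ℝ) i, U.toFun t (e i) = V.toFun t (e i)) : U = V :=
  UnitaryGroup.ext <| funext fun t =>
    LinearIsometryEquiv.toLinearIsometry_injective (isometry_eq_of_eqOn_total he (h t))

theorem graph_generator_eq [CompleteSpace E] {U : UnitaryGroup E}
    (he : Dense (Submodule.span ℂ (Set.range e) : Set E))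
    (h : ∀ (t : ℝ) i, U.toFun t (e i) = Complex.exp (Complex.I * t * μ i) • e i) :
    U.generator.graph = (eigenGraph e μ).topologicalClosure := by
  rw [generator_graph]
  exact eq_topologicalClosure_eigenGraph U.isClosed_generatorGraph
    (fun p hp q hq => U.inner_generatorGraph hp hq) he
    fun i => apply_eq_exp_smul_iff.1 fun t => h t i

theorem exists_toFun_eq {T : ℝ → E →ₗᵢ[ℂ] E}
    (he : Dense (Submodule.span ℂ (Set.range e) : Set E))
    (h : ∀ (t : ℝ) i, T t (e i) = Complex.exp (Complex.I * t * μ i) • e i) :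
    ∃ U : UnitaryGroup E, ∀ t x, U.toFun t x = T t x := by
  have hzero : T 0 = LinearIsometry.id := isometry_eq_of_eqOn_total he fun i => by simp [h]
  have hadd (s t) : T (s + t) = (T s).comp (T t) := isometry_eq_of_eqOn_total he fun i => by
    rw [LinearIsometry.coe_comp, Function.comp_apply, h, h, map_smul, h, smul_smul,
      ← Complex.exp_add]
    push_cast
    ring_nf
  have hsurj (t) : Function.Surjective (T t) := fun x =>
    ⟨T (-t) x, by
      rw [← Function.comp_apply (f := T t), ← LinearIsometry.coe_comp, ← hadd, add_neg_cancel,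
        hzero, LinearIsometry.id_apply]⟩
  exact ⟨{
    toFun t := LinearIsometryEquiv.ofSurjective (T t) (hsurj t)
    map_zero := LinearIsometryEquiv.toLinearIsometry_injective hzero
    map_add s t := LinearIsometryEquiv.toLinearIsometry_injective (hadd s t)
    continuous := continuous_apply_of_total he fun i => by simp only [h]; fun_prop },
    fun _ _ => rfl⟩

end UnitaryGroup

section HilbertBasis
variable {H : Type*} [NormedAddCommGroup H] [InnerProductSpace ℂ H] {ι : Type*}
  (v : HilbertBasis ι ℂ H) (m : ι → ℝ)

theorem hilbertBasis_dense_span : Dense (Submodule.span ℂ (Set.range v) : Set H) :=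
  Submodule.dense_iff_topologicalClosure_eq_top.2 v.dense_span

theorem exists_diagonal_isometry [CompleteSpace H] {c : ι → ℂ} (hc : ∀ i, ‖c i‖ = 1) :
    ∃ T : H →ₗᵢ[ℂ] H, ∀ i, T (v i) = c i • v i := by
  have hortho : Orthonormal ℂ fun i => c i • v i := by
    refine ⟨fun i => by rw [norm_smul, hc, v.orthonormal.1 i, one_mul], fun i j hij => ?_⟩
    simp only [inner_smul_left, inner_smul_right, v.orthonormal.2 hij, mul_zero]
  refine ⟨hortho.orthogonalFamily.linearIsometry.comp v.repr.toLinearIsometry, fun i => ?_⟩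
  classical
  rw [LinearIsometry.coe_comp, Function.comp_apply, LinearIsometryEquiv.coe_toLinearIsometry,
    v.repr_self, hortho.orthogonalFamily.linearIsometry_apply_single,
    LinearIsometry.toSpanSingleton_apply, one_smul]

theorem exists_unitaryGroup_diagonal [CompleteSpace H] :
    ∃ U : UnitaryGroup H, ∀ (t : ℝ) i,
      U.toFun t (v i) = Complex.exp (Complex.I * t * m i) • v i := by
  have hnorm (t : ℝ) (i : ι) : ‖Complex.exp (Complex.I * t * m i)‖ = 1 := by
    rw [mul_assoc, mul_comm, ← Complex.ofReal_mul, Complex.norm_exp_ofReal_mul_I]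
  choose T hT using fun t => exists_diagonal_isometry v (hnorm t)
  obtain ⟨U, hU⟩ := UnitaryGroup.exists_toFun_eq (hilbertBasis_dense_span v) hT
  exact ⟨U, fun t i => by rw [hU, hT]⟩

variable {v m} {A : H →ₗ.[ℂ] H}

theorem inner_graph_of_isSelfAdjoint [CompleteSpace H] (hA : IsSelfAdjoint A) {p q : H × H}
    (hp : p ∈ A.graph) (hq : q ∈ A.graph) : ⟪p.2, q.1⟫_ℂ = ⟪p.1, q.2⟫_ℂ := by
  obtain ⟨x, hx, hx'⟩ := A.mem_graph_iff.1 hp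
  obtain ⟨y, hy, hy'⟩ := A.mem_graph_iff.1 hq
  have hadj := LinearPMap.adjoint_isFormalAdjoint hA.dense_domain
  rw [LinearPMap.isSelfAdjoint_def.1 hA] at hadj
  rw [← hx, ← hx', ← hy, ← hy']
  exact hadj x y

theorem existsUnique_generator_eq [CompleteSpace H] (hA : IsSelfAdjoint A)
    (hv : ∀ i, (v i, (m i : ℂ) • v i) ∈ A.graph) : ∃! U : UnitaryGroup H, U.generator = A := by
  have hdense := hilbertBasis_dense_span v
  obtain ⟨U, hU⟩ := exists_unitaryGroup_diagonal v m
  refine ⟨U, LinearPMap.eq_of_eq_graph ?_, fun W hW => ?_⟩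
  · rw [UnitaryGroup.graph_generator_eq hdense hU]
    exact (eq_topologicalClosure_eigenGraph hA.isClosed
      (fun p hp q hq => inner_graph_of_isSelfAdjoint hA hp hq) hdense hv).symm
  · refine UnitaryGroup.eq_of_apply_eq hdense fun t i => ?_
    rw [hU, UnitaryGroup.apply_eq_exp_smul_iff.2]
    rw [← W.generator_graph, hW]
    exact hv i

end HilbertBasis

section StarAdjoin
variable {R B : Type*} [CommSemiring R] [StarRing R] [Semiring B] [StarRing B] [Algebra R B]
  [StarModule R B]

theorem adjoin_subset_of_mul_mem {s : Set B} {C : Submodule R B} (hone : 1 ∈ C)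
    (hmul : ∀ x ∈ s, ∀ c ∈ C, x * c ∈ C) (hstar : ∀ x ∈ s, ∀ c ∈ C, star x * c ∈ C) :
    (StarAlgebra.adjoin R s : Set B) ⊆ C := by
  intro x hx
  suffices ∀ c ∈ C, x * c ∈ C by simpa only [mul_one, SetLike.mem_coe] using this 1 hone
  change x ∈ Algebra.adjoin R (s ∪ star s) at hx
  induction hx using Algebra.adjoin_induction with
  | mem x hx =>
    rcases hx with hx | hx
    · exact hmul x hx
    · simpa only [star_star] using hstar (star x) hx
  | algebraMap r => exact fun c hc => Algebra.smul_def r c ▸ C.smul_mem r hc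
  | add x y _ _ hx hy => exact fun c hc => add_mul x y c ▸ C.add_mem (hx c hc) (hy c hc)
  | mul x y _ _ hx hy => exact fun c hc => (mul_assoc x y c).symm ▸ hx _ (hy c hc)

end StarAdjoin

section Modes
variable {B ι : Type*} [Ring B] [StarRing B] {b : ι → B}

/-- The canonical anticommutation relations for a family of annihilation operators indexed by an
orthonormal family of modes. -/
structure IsModeCAR (b : ι → B) : Prop where
  anticomm : ∀ i j, b i * b j + b j * b i = 0
  anticomm_star_self : ∀ i, star (b i) * b i + b i * star (b i) = 1
  anticomm_star_of_ne : ∀ i j, i ≠ j → star (b i) * b j + b j * star (b i) = 0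

open Classical in
/-- The particle–hole transform, exchanging the annihilation and creation operators of the modes in
`I₀`. -/
def particleHole (I₀ : Set ι) (b : ι → B) (i : ι) : B := if i ∈ I₀ then star (b i) else b i

theorem particleHole_of_mem {I₀ : Set ι} {i : ι} (hi : i ∈ I₀) :
    particleHole I₀ b i = star (b i) := if_pos hi

theorem particleHole_of_notMem {I₀ : Set ι} {i : ι} (hi : i ∉ I₀) :
    particleHole I₀ b i = b i := if_neg hi

/-- The product `b*(i₁) ⋯ b*(iₙ)` of the creation operators of the modes in a list. -/
def creWord (b : ι → B) (l : List ι) : B := (l.map fun i => star (b i)).prod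

theorem creWord_nil : creWord b [] = 1 := rfl

theorem creWord_cons (i : ι) (l : List ι) : creWord b (i :: l) = star (b i) * creWord b l :=
  List.prod_cons

theorem creWord_append (l₁ l₂ : List ι) :
    creWord b (l₁ ++ l₂) = creWord b l₁ * creWord b l₂ := by
  simp only [creWord, List.map_append, List.prod_append]

theorem creWord_particleHole_of_mem {I₀ : Set ι} {l : List ι} (hl : ∀ i ∈ l, i ∈ I₀) :
    creWord (particleHole I₀ b) l = (l.map b).prod := by
  unfold creWord
  rw [List.map_congr_left fun i hi => by rw [particleHole_of_mem (hl i hi), star_star]]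

theorem creWord_particleHole_of_notMem {I₀ : Set ι} {l : List ι} (hl : ∀ i ∈ l, i ∉ I₀) :
    creWord (particleHole I₀ b) l = creWord b l := by
  unfold creWord
  rw [List.map_congr_left fun i hi => by rw [particleHole_of_notMem (hl i hi)]]

namespace IsModeCAR

theorem anticomm_star_star (hb : IsModeCAR b) (i j : ι) :
    star (b i) * star (b j) + star (b j) * star (b i) = 0 := by
  rw [← star_mul, ← star_mul, ← star_add, hb.anticomm, star_zero]

theorem anticomm_of_ne (hb : IsModeCAR b) {i j : ι} (hij : i ≠ j) :
    b i * star (b j) + star (b j) * b i = 0 := by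
  rw [add_comm, hb.anticomm_star_of_ne j i hij.symm]

theorem particleHole (hb : IsModeCAR b) (I₀ : Set ι) : IsModeCAR (particleHole I₀ b) where
  anticomm i j := by
    unfold _root_.particleHole
    split_ifs with hi hj hj
    · exact hb.anticomm_star_star i j
    · exact hb.anticomm_star_of_ne i j (ne_of_mem_of_not_mem hi hj)
    · exact hb.anticomm_of_ne (ne_of_mem_of_not_mem hj hi).symm
    · exact hb.anticomm i j
  anticomm_star_self i := by
    unfold _root_.particleHole
    split_ifs
    · rw [star_star, add_comm, hb.anticomm_star_self]
    · exact hb.anticomm_star_self i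
  anticomm_star_of_ne i j hij := by
    unfold _root_.particleHole
    split_ifs
    · rw [star_star]; exact hb.anticomm_of_ne hij
    · rw [star_star]; exact hb.anticomm i j
    · exact hb.anticomm_star_star i j
    · exact hb.anticomm_star_of_ne i j hij

theorem star_mul_star (hb : IsModeCAR b) (i j : ι) :
    star (b i) * star (b j) = -(star (b j) * star (b i)) := by
  rw [eq_neg_iff_add_eq_zero, hb.anticomm_star_star]

theorem mul_star_self (hb : IsModeCAR b) (i : ι) :
    b i * star (b i) = 1 - star (b i) * b i :=
  eq_sub_of_add_eq' (hb.anticomm_star_self i)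

theorem mul_star_of_ne (hb : IsModeCAR b) {i j : ι} (hij : i ≠ j) :
    b i * star (b j) = -(star (b j) * b i) :=
  eq_neg_of_add_eq_zero_left (hb.anticomm_of_ne hij)

theorem creWord_eq_or_eq_neg_of_perm (hb : IsModeCAR b) {l₁ l₂ : List ι} (h : l₁.Perm l₂) :
    creWord b l₁ = creWord b l₂ ∨ creWord b l₁ = -creWord b l₂ := by
  induction h with
  | nil => exact .inl rfl
  | cons i _ ih =>
    rw [creWord_cons, creWord_cons, ← mul_neg]
    exact ih.imp (congrArg _) (congrArg _)
  | swap i j l =>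
    right
    simp only [creWord_cons, ← mul_assoc]
    rw [hb.star_mul_star, neg_mul]
  | trans _ _ ih₁ ih₂ =>
    rcases ih₁ with h₁ | h₁ <;> rcases ih₂ with h₂ | h₂ <;> simp [h₁, h₂]

theorem number_mul_star [DecidableEq ι] (hb : IsModeCAR b) (i j : ι) :
    star (b i) * b i * star (b j) =
      star (b j) * (star (b i) * b i) + if j = i then star (b j) else 0 := by
  split_ifs with hij
  · subst hij
    have hsq : star (b j) * star (b j) * b j = -(star (b j) * star (b j) * b j) := by
      rw [← neg_mul, ← hb.star_mul_star]
    rw [mul_assoc, hb.mul_star_self, mul_sub, mul_one, ← mul_assoc, sub_eq_add_neg, ← hsq,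
      add_comm]
  · rw [mul_assoc, hb.mul_star_of_ne (Ne.symm hij), mul_neg, ← mul_assoc, hb.star_mul_star,
      neg_mul, neg_neg, add_zero, mul_assoc]

theorem number_mul_creWord [DecidableEq ι] (hb : IsModeCAR b) (i : ι) (l : List ι) :
    star (b i) * b i * creWord b l =
      creWord b l * (star (b i) * b i) + l.count i • creWord b l := by
  induction l with
  | nil => simp [creWord_nil]
  | cons j l ih =>
    rw [creWord_cons, ← mul_assoc, hb.number_mul_star, add_mul, mul_assoc (star (b j)), ih,
      List.count_cons, add_smul, mul_add, mul_smul_comm, mul_assoc (star (b j)), add_assoc]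
    by_cases hij : j = i <;> simp [hij]

end IsModeCAR

section NormalOrder
variable (R : Type*) [CommRing R] [Algebra R B]

/-- The elements that are sums of a linear combination of creation words and an element of the left
ideal generated by the annihilation operators. -/
def normallyOrdered (b : ι → B) : Submodule R B :=
  Submodule.span R (Set.range (creWord b)) ⊔ (Ideal.span (Set.range b)).restrictScalars R

variable {R}

theorem creWord_mem_normallyOrdered (l : List ι) : creWord b l ∈ normallyOrdered R b :=
  Submodule.mem_sup_left (Submodule.subset_span ⟨l, rfl⟩)

theorem mem_normallyOrdered_of_mem_ideal {x : B} (hx : x ∈ Ideal.span (Set.range b)) :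
    x ∈ normallyOrdered R b :=
  Submodule.mem_sup_right hx

theorem mul_mem_normallyOrdered {x y : B} (hx : ∀ l, x * creWord b l ∈ normallyOrdered R b)
    (hy : y ∈ normallyOrdered R b) : x * y ∈ normallyOrdered R b := by
  suffices normallyOrdered R b ≤ (normallyOrdered R b).comap (LinearMap.mulLeft R x) from this hy
  refine sup_le (Submodule.span_le.2 ?_) fun n hn =>
    mem_normallyOrdered_of_mem_ideal (Ideal.mul_mem_left _ x hn)
  rintro _ ⟨l, rfl⟩
  exact hx l

theorem star_mul_mem_normallyOrdered (i : ι) {y : B} (hy : y ∈ normallyOrdered R b) :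
    star (b i) * y ∈ normallyOrdered R b :=
  mul_mem_normallyOrdered
    (fun l => by rw [← creWord_cons]; exact creWord_mem_normallyOrdered (i :: l)) hy

theorem IsModeCAR.mul_mem_normallyOrdered (hb : IsModeCAR b) (i : ι) {y : B}
    (hy : y ∈ normallyOrdered R b) : b i * y ∈ normallyOrdered R b := by
  refine _root_.mul_mem_normallyOrdered (R := R) (fun l => ?_) hy
  induction l with
  | nil =>
    rw [creWord_nil, mul_one]
    exact mem_normallyOrdered_of_mem_ideal (Ideal.subset_span ⟨i, rfl⟩)
  | cons j l ih =>
    rw [creWord_cons, ← mul_assoc]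
    by_cases hij : i = j
    · rw [← hij, hb.mul_star_self, sub_mul, one_mul, mul_assoc]
      exact sub_mem (creWord_mem_normallyOrdered l) (star_mul_mem_normallyOrdered i ih)
    · rw [hb.mul_star_of_ne hij, neg_mul, mul_assoc]
      exact neg_mem (star_mul_mem_normallyOrdered j ih)

theorem map_mem_ideal_span {γ : B →⋆ₐ[R] B} {c : ι → R} (hγ : ∀ i, γ (b i) = c i • b i) {x : B}
    (hx : x ∈ Ideal.span (Set.range b)) : γ x ∈ Ideal.span (Set.range b) := by
  suffices Ideal.span (Set.range b) ≤ (Ideal.span (Set.range b)).comap γ from this hx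
  refine Ideal.span_le.2 (Set.range_subset_iff.2 fun i => ?_)
  change γ (b i) ∈ Ideal.span (Set.range b)
  rw [hγ, ← smul_one_mul]
  exact Ideal.mul_mem_left _ _ (Ideal.subset_span ⟨i, rfl⟩)

variable [StarRing R] [StarModule R B]

theorem IsModeCAR.adjoin_subset_normallyOrdered (hb : IsModeCAR b) :
    (StarAlgebra.adjoin R (Set.range b) : Set B) ⊆ normallyOrdered R b := by
  refine adjoin_subset_of_mul_mem (creWord_mem_normallyOrdered []) ?_ ?_
  · rintro _ ⟨i, rfl⟩ y hy
    exact hb.mul_mem_normallyOrdered i hy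
  · rintro _ ⟨i, rfl⟩ y hy
    exact star_mul_mem_normallyOrdered i hy

theorem map_creWord {γ : B →⋆ₐ[R] B} {c : ι → R} (hγ : ∀ i, γ (b i) = c i • b i) (l : List ι) :
    γ (creWord b l) = (l.map fun i => star (c i)).prod • creWord b l := by
  induction l with
  | nil => rw [creWord_nil, map_one, List.map_nil, List.prod_nil, one_smul]
  | cons i l ih =>
    rw [creWord_cons, map_mul, map_star, hγ, ih, star_smul, smul_mul_smul_comm, List.map_cons,
      List.prod_cons]

theorem adjoin_le_adjoin_particleHole (I₀ : Set ι) (b : ι → B) :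
    StarAlgebra.adjoin R (Set.range b) ≤
      StarAlgebra.adjoin R (Set.range (particleHole I₀ b)) := by
  refine StarAlgebra.adjoin_le ?_
  rintro _ ⟨i, rfl⟩
  have hmem := StarAlgebra.subset_adjoin R _ (Set.mem_range_self (f := particleHole I₀ b) i)
  by_cases hi : i ∈ I₀
  · rw [particleHole_of_mem hi] at hmem
    simpa only [star_star, SetLike.mem_coe] using star_mem hmem
  · rwa [particleHole_of_notMem hi] at hmem

end NormalOrder

end Modes

theorem mem_closure_left_of_inner_eq_zero {𝕜 E : Type*} [RCLike 𝕜] [SeminormedAddCommGroup E]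
    [InnerProductSpace 𝕜 E] {M N : Submodule 𝕜 E} {x : E}
    (hx : x ∈ closure ((M ⊔ N : Submodule 𝕜 E) : Set E))
    (hinner : ∀ y ∈ M, ∀ z ∈ N, inner 𝕜 (x - y) z = 0) : x ∈ closure (M : Set E) := by
  refine Metric.mem_closure_iff.2 fun ε hε => ?_
  obtain ⟨w, hw, hxw⟩ := Metric.mem_closure_iff.1 hx ε hε
  obtain ⟨y, hy, z, hz, rfl⟩ := Submodule.mem_sup.1 hw
  have hpyth : ‖x - (y + z)‖ * ‖x - (y + z)‖ = ‖x - y‖ * ‖x - y‖ + ‖-z‖ * ‖-z‖ := by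
    rw [← sub_sub, sub_eq_add_neg (x - y)]
    exact norm_add_sq_eq_norm_sq_add_norm_sq_of_inner_eq_zero (𝕜 := 𝕜) _ _
      (hinner y hy (-z) (N.neg_mem hz))
  refine ⟨y, hy, lt_of_le_of_lt ?_ hxw⟩
  rw [dist_eq_norm, dist_eq_norm]
  exact nonneg_le_nonneg_of_sq_le_sq (norm_nonneg _)
    (hpyth ▸ le_add_of_nonneg_right (mul_self_nonneg _))

section GNSMap
variable {A B : Type*} [CStarAlgebra A] [PartialOrder A] [StarOrderedRing A] [CStarAlgebra B]
  [PartialOrder B] [StarOrderedRing B] {ψ : A →ₚ[ℂ] ℂ} {φ : B →ₚ[ℂ] ℂ}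

/-- The isometry of pre-GNS spaces induced by a homomorphism that intertwines two functionals. -/
def preGNSMap (f : A →⋆ₐ[ℂ] B) (hf : ∀ x, φ (f x) = ψ x) : ψ.PreGNS →ₗᵢ[ℂ] φ.PreGNS where
  toLinearMap := φ.toPreGNS.toLinearMap ∘ₗ f.toLinearMap ∘ₗ ψ.ofPreGNS.toLinearMap
  norm_map' x := by
    rw [PositiveLinearMap.preGNS_norm_def, PositiveLinearMap.preGNS_norm_def, ← hf, map_mul f,
      map_star f]
    rfl

/-- The isometry of GNS spaces induced by a homomorphism that intertwines two functionals. -/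
def gnsMap (f : A →⋆ₐ[ℂ] B) (hf : ∀ x, φ (f x) = ψ x) : ψ.GNS →ₗᵢ[ℂ] φ.GNS where
  toLinearMap := (preGNSMap f hf).toContinuousLinearMap.completion.toLinearMap
  norm_map' := (preGNSMap f hf).isometry.completion_map.norm_map_of_map_zero (map_zero
    (preGNSMap f hf).toContinuousLinearMap.completion)

theorem gnsMap_coe (f : A →⋆ₐ[ℂ] B) (hf : ∀ x, φ (f x) = ψ x) (x : A) :
    gnsMap f hf (ψ.toPreGNS x : ψ.PreGNS) = (φ.toPreGNS (f x) : φ.PreGNS) :=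
  ContinuousLinearMap.completion_apply_coe (preGNSMap f hf).toContinuousLinearMap _

end GNSMap

section Vacuum
variable {B ι κ : Type*} [CStarAlgebra B] [PartialOrder B] [StarOrderedRing B] {φ : B →ₚ[ℂ] ℂ}
  {b : ι → B}

theorem apply_mul_eq_zero_of_apply_star_mul_self {x : B} (hx : φ (star x * x) = 0) (y : B) :
    φ (y * x) = 0 := by
  have hnorm : ‖φ.toPreGNS x‖ = 0 := by
    rw [PositiveLinearMap.preGNS_norm_def, PositiveLinearMap.ofPreGNS_toPreGNS, hx,
      Complex.zero_re, Real.sqrt_zero]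
  simpa only [PositiveLinearMap.preGNS_inner_def, PositiveLinearMap.ofPreGNS_toPreGNS, star_star]
    using inner_eq_zero_of_right (𝕜 := ℂ) (φ.toPreGNS (star y)) hnorm

/-- `φ` is a multiple of the vacuum state: the annihilation operators `b i` kill its GNS vector. -/
def IsVacuum (φ : B →ₚ[ℂ] ℂ) (b : ι → B) : Prop := ∀ i, φ (star (b i) * b i) = 0

namespace IsVacuum

theorem apply_mul_eq_zero (hφ : IsVacuum φ b) {x : B} (hx : x ∈ Ideal.span (Set.range b))
    (y : B) : φ (y * x) = 0 := by
  induction hx using Submodule.span_induction generalizing y with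
  | mem x hx => obtain ⟨i, rfl⟩ := hx; exact apply_mul_eq_zero_of_apply_star_mul_self (hφ i) y
  | zero => rw [mul_zero, map_zero]
  | add x z _ _ hx hz => rw [mul_add, map_add, hx, hz, add_zero]
  | smul z x _ hx => rw [smul_eq_mul, ← mul_assoc, hx]

theorem apply_creWord_eq_zero (hφ : IsVacuum φ b) {l : List ι} (hl : l ≠ []) :
    φ (creWord b l) = 0 := by
  obtain ⟨i, l, rfl⟩ := List.exists_cons_of_ne_nil hl
  have hstar : φ (star (star (b i) * creWord b l)) = 0 := by
    rw [star_mul, star_star, apply_mul_eq_zero_of_apply_star_mul_self (hφ i)]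
  rwa [map_star, star_eq_zero] at hstar

end IsVacuum

section Diagonal
variable {γ : B →⋆ₐ[ℂ] B} {c : ι → ℂ}

theorem IsVacuum.apply_map (hφ : IsVacuum φ b) (hd : Dense (normallyOrdered ℂ b : Set B))
    (hγ : ∀ i, γ (b i) = c i • b i) (x : B) : φ (γ x) = φ x := by
  suffices normallyOrdered ℂ b ≤ LinearMap.eqLocus (φ.toLinearMap ∘ₗ γ.toLinearMap) φ.toLinearMap
    from congrFun (((map_continuous φ).comp (map_continuous γ)).ext_on hd (map_continuous φ) this) x
  refine sup_le (Submodule.span_le.2 ?_) fun n hn => ?_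
  · rintro _ ⟨l, rfl⟩
    change φ (γ (creWord b l)) = φ (creWord b l)
    rw [map_creWord hγ]
    by_cases hl : l = []
    · simp [hl]
    · rw [map_smul, hφ.apply_creWord_eq_zero hl, smul_zero]
  · change φ (γ n) = φ n
    simpa only [one_mul] using (hφ.apply_mul_eq_zero (map_mem_ideal_span hγ hn) 1).trans
      (hφ.apply_mul_eq_zero hn 1).symm

theorem IsVacuum.apply_star_mul_creWord_eq_zero (hφ : IsVacuum φ b)
    (hd : Dense (normallyOrdered ℂ b : Set B)) (hγ : ∀ i, γ (b i) = c i • b i) {y : B}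
    (hy : γ y = y) {l : List ι} (hl : (l.map fun i => star (c i)).prod ≠ 1) :
    φ (star y * creWord b l) = 0 := by
  have hinv := hφ.apply_map hd hγ (star y * creWord b l)
  rw [map_mul γ, map_star γ, hy, map_creWord hγ, mul_smul_comm, map_smul, smul_eq_mul] at hinv
  exact (mul_left_eq_self₀.1 hinv).resolve_left hl

end Diagonal

theorem continuous_toPreGNS : Continuous φ.toPreGNS := by
  refine continuous_of_continuousAt_zero φ.toPreGNS ?_
  have hcont : Continuous fun x => √(φ (star x * x)).re := by fun_prop
  rw [ContinuousAt, map_zero, tendsto_zero_iff_norm_tendsto_zero]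
  simpa only [PositiveLinearMap.preGNS_norm_def, PositiveLinearMap.ofPreGNS_toPreGNS, mul_zero,
    map_zero, Complex.zero_re, Real.sqrt_zero] using hcont.tendsto 0

theorem IsVacuum.toPreGNS_mem_closure_of_fixed (hφ : IsVacuum φ b)
    (hd : Dense (normallyOrdered ℂ b : Set B)) {γ : κ → B →⋆ₐ[ℂ] B} {c : κ → ι → ℂ}
    (hγ : ∀ k i, γ k (b i) = c k i • b i) {x : B} (hx : ∀ k, γ k x = x) :
    φ.toPreGNS x ∈ closure (Submodule.span ℂ ((φ.toPreGNS ∘ creWord b) ''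
      {l | ∀ k, (l.map fun i => star (c k i)).prod = 1}) : Set φ.PreGNS) := by
  set M := Submodule.span ℂ ((φ.toPreGNS ∘ creWord b) ''
    {l | ∀ k, (l.map fun i => star (c k i)).prod = 1})
  let F : Submodule ℂ B := ⨅ k, LinearMap.eqLocus (γ k).toLinearMap LinearMap.id
  let N : Submodule ℂ φ.PreGNS := ⨅ y : F, LinearMap.ker (innerₛₗ ℂ (φ.toPreGNS (y : B)))
  have mem_F {y : B} : y ∈ F ↔ ∀ k, γ k y = y := Submodule.mem_iInf _
  have mem_N {z : B} (hz : ∀ y ∈ F, φ (star y * z) = 0) : φ.toPreGNS z ∈ N :=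
    (Submodule.mem_iInf _).2 fun y => hz y y.2
  have hMF : M ≤ F.map φ.toPreGNS.toLinearMap := by
    refine Submodule.span_le.2 ?_
    rintro _ ⟨l, hl, rfl⟩
    exact ⟨creWord b l, mem_F.2 fun k => by rw [map_creWord (hγ k), hl k, one_smul], rfl⟩
  have hword (l) : φ.toPreGNS (creWord b l) ∈ M ⊔ N := by
    by_cases hl : ∀ k, (l.map fun i => star (c k i)).prod = 1
    · exact Submodule.mem_sup_left (Submodule.subset_span ⟨l, hl, rfl⟩)
    · obtain ⟨k, hk⟩ := not_forall.1 hl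
      exact Submodule.mem_sup_right <| mem_N fun y hy =>
        hφ.apply_star_mul_creWord_eq_zero hd (hγ k) (mem_F.1 hy k) hk
  have hle : normallyOrdered ℂ b ≤ (M ⊔ N).comap φ.toPreGNS.toLinearMap :=
    sup_le (Submodule.span_le.2 (Set.range_subset_iff.2 hword)) fun n hn =>
      Submodule.mem_sup_right <| mem_N fun y _ => hφ.apply_mul_eq_zero hn (star y)
  refine mem_closure_left_of_inner_eq_zero (map_mem_closure continuous_toPreGNS (hd x) hle) ?_
  rintro y hy z hz
  obtain ⟨y, hyF, rfl⟩ := hMF hy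
  exact (Submodule.mem_iInf _).1 hz ⟨x - y, F.sub_mem (mem_F.2 hx) hyF⟩

end Vacuum

theorem IsCAR.isModeCAR {H B ι : Type*} [NormedAddCommGroup H] [InnerProductSpace ℂ H]
    [CStarAlgebra B] {a : H →ₗ⋆[ℂ] B} (ha : IsCAR a) {v : ι → H} (hv : Orthonormal ℂ v) :
    IsModeCAR (a ∘ v) where
  anticomm i j := ha.anticomm (v i) (v j)
  anticomm_star_self i := by
    rw [Function.comp_apply, ha.anticomm_star, inner_self_eq_norm_sq_to_K, hv.1 i]
    simp only [one_pow, map_one]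
  anticomm_star_of_ne i j hij := by
    rw [Function.comp_apply, Function.comp_apply, ha.anticomm_star, hv.2 hij.symm, map_zero]

section Energy
variable {ι : Type*} {I₀ : Set ι}

/-- The energy of a quasiparticle: it is `m i` for a particle outside of `I₀` and `-m i` for a hole
in `I₀`. -/
def modeEnergy (I₀ : Set ι) (m : ι → ℝ) : ι → ℝ := I₀ᶜ.indicator m - I₀.indicator m

theorem modeEnergy_of_mem (m : ι → ℝ) {i : ι} (hi : i ∈ I₀) : modeEnergy I₀ m i = -m i := by
  simp [modeEnergy, hi]

theorem modeEnergy_of_notMem (m : ι → ℝ) {i : ι} (hi : i ∉ I₀) : modeEnergy I₀ m i = m i := by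
  simp [modeEnergy, hi]

/-- The total energy of the quasiparticles in a list. For `m = 1` it is their charge, the number of
particles minus the number of holes. -/
def wordEnergy (I₀ : Set ι) (m : ι → ℝ) (l : List ι) : ℝ := (l.map (modeEnergy I₀ m)).sum

theorem wordEnergy_append (m : ι → ℝ) (l₁ l₂ : List ι) :
    wordEnergy I₀ m (l₁ ++ l₂) = wordEnergy I₀ m l₁ + wordEnergy I₀ m l₂ := by
  simp only [wordEnergy, List.map_append, List.sum_append]

theorem wordEnergy_eq_of_perm (m : ι → ℝ) {l₁ l₂ : List ι} (h : l₁.Perm l₂) :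
    wordEnergy I₀ m l₁ = wordEnergy I₀ m l₂ :=
  (h.map _).sum_eq

theorem wordEnergy_one_of_mem {l : List ι} (hl : ∀ i ∈ l, i ∈ I₀) :
    wordEnergy I₀ 1 l = -l.length := by
  rw [wordEnergy, List.map_congr_left fun i hi => modeEnergy_of_mem 1 (hl i hi)]
  simp

theorem wordEnergy_one_of_notMem {l : List ι} (hl : ∀ i ∈ l, i ∉ I₀) :
    wordEnergy I₀ 1 l = l.length := by
  rw [wordEnergy, List.map_congr_left fun i hi => modeEnergy_of_notMem 1 (hl i hi)]
  simp

theorem prod_star_exp_modeEnergy (I₀ : Set ι) (m : ι → ℝ) (t : ℝ) (l : List ι) :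
    (l.map fun i => star (Complex.exp (-(Complex.I * t * modeEnergy I₀ m i)))).prod =
      Complex.exp (Complex.I * t * wordEnergy I₀ m l) := by
  have hstar (i : ι) : star (Complex.exp (-(Complex.I * t * modeEnergy I₀ m i))) =
      Complex.exp (Complex.I * t * modeEnergy I₀ m i) := by
    rw [← starRingEnd_apply, ← Complex.exp_conj]
    simp
  simp only [hstar, wordEnergy]
  induction l with
  | nil => simp
  | cons i l ih =>
    rw [List.map_cons, List.prod_cons, ih, ← Complex.exp_add, List.map_cons, List.sum_cons,
      Complex.ofReal_add, mul_add]

theorem eq_zero_of_exp_eq_one {q : ℝ} (h : ∀ t : ℝ, Complex.exp (Complex.I * t * q) = 1) :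
    q = 0 := by
  by_contra hq
  have harg : Complex.I * (Real.pi / q : ℝ) * q = Real.pi * Complex.I := by
    have : (q : ℂ) ≠ 0 := Complex.ofReal_ne_zero.2 hq
    push_cast
    field_simp
  have hπ := h (Real.pi / q)
  rw [harg, Complex.exp_pi_mul_I] at hπ
  norm_num at hπ

end Energy

namespace CARAlgebra
variable {H : Type u} [NormedAddCommGroup H] [InnerProductSpace ℂ H]

theorem topologicalClosure_adjoin_range_a :
    (StarAlgebra.adjoin ℂ (Set.range (a (H := H)))).topologicalClosure = ⊤ := by
  let j : CARAlgebra H →⋆ₐ[ℂ] CARProd H := (CARProd.carSubalgebra H).subtype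
  have hmap : (StarAlgebra.adjoin ℂ (Set.range (a (H := H)))).map j =
      StarAlgebra.adjoin ℂ (Set.range (CARProd.a (H := H))) := by
    rw [StarAlgHom.map_adjoin, ← Set.range_comp]
    rfl
  refine eq_top_iff.2 fun x _ => (closure_subtype (p := (· ∈ CARProd.carSubalgebra H))).2 ?_
  have hx : (x.1 : CARProd H) ∈
      closure (StarAlgebra.adjoin ℂ (Set.range (CARProd.a (H := H))) : Set (CARProd H)) := x.2
  rw [← hmap] at hx
  exact hx

theorem continuous_a : Continuous (a : H → CARAlgebra H) :=
  AddMonoidHomClass.continuous_of_bound (a : H →ₗ⋆[ℂ] CARAlgebra H) 1 fun h => by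
    rw [one_mul]; exact isCAR_a.norm_le h

variable {ι : Type*} {v : ι → H}

theorem dense_adjoin_range_a_comp (hd : Dense (Submodule.span ℂ (Set.range v) : Set H)) :
    Dense (StarAlgebra.adjoin ℂ (Set.range (a ∘ v)) : Set (CARAlgebra H)) := by
  set S := (StarAlgebra.adjoin ℂ (Set.range (a ∘ v))).topologicalClosure
  have hspan : Submodule.span ℂ (Set.range v) ≤
      (Subalgebra.toSubmodule S.toSubalgebra).comap (a (H := H)) :=
    Submodule.span_le.2 <| Set.range_subset_iff.2 fun i =>
      subset_closure (StarAlgebra.subset_adjoin ℂ _ ⟨i, rfl⟩)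
  have hmem (h : H) : a h ∈ S :=
    closure_minimal hspan ((StarSubalgebra.isClosed_topologicalClosure _).preimage continuous_a)
      (hd h)
  have hle : (StarAlgebra.adjoin ℂ (Set.range (a (H := H)))).topologicalClosure ≤ S :=
    StarSubalgebra.topologicalClosure_minimal
      (StarAlgebra.adjoin_le (Set.range_subset_iff.2 hmem))
      (StarSubalgebra.isClosed_topologicalClosure _)
  exact fun x => hle (topologicalClosure_adjoin_range_a.ge (Set.mem_univ x))

/-- The annihilation operators of the quasiparticles over the vacuum in which exactly the modes in
`I₀` are occupied. -/
def quasiparticle (v : ι → H) (I₀ : Set ι) : ι → CARAlgebra H := particleHole I₀ (a ∘ v)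

theorem isModeCAR_quasiparticle (hv : Orthonormal ℂ v) (I₀ : Set ι) :
    IsModeCAR (quasiparticle v I₀) :=
  (isCAR_a.isModeCAR hv).particleHole I₀

theorem dense_normallyOrdered_quasiparticle (hv : Orthonormal ℂ v)
    (hd : Dense (Submodule.span ℂ (Set.range v) : Set H)) (I₀ : Set ι) :
    Dense (normallyOrdered ℂ (quasiparticle v I₀) : Set (CARAlgebra H)) :=
  (dense_adjoin_range_a_comp hd).mono fun _ hx =>
    (isModeCAR_quasiparticle hv I₀).adjoin_subset_normallyOrdered
      (adjoin_le_adjoin_particleHole I₀ (a ∘ v) hx)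

theorem bogoliubov_quasiparticle (I₀ : Set ι) {U : H ≃ₗᵢ[ℂ] H} {m : ι → ℝ} {t : ℝ}
    (hU : ∀ i, U (v i) = Complex.exp (Complex.I * t * m i) • v i) (i : ι) :
    bogoliubov U (quasiparticle v I₀ i) =
      Complex.exp (-(Complex.I * t * modeEnergy I₀ m i)) • quasiparticle v I₀ i := by
  have ha : bogoliubov U (a (v i)) = Complex.exp (-(Complex.I * t * m i)) • a (v i) := by
    rw [bogoliubov_a, hU, map_smulₛₗ, ← Complex.exp_conj]
    simp
  by_cases hi : i ∈ I₀
  · rw [quasiparticle, particleHole_of_mem hi, modeEnergy_of_mem m hi, map_star,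
      Function.comp_apply, ha, star_smul, ← starRingEnd_apply, ← Complex.exp_conj]
    simp
  · rw [quasiparticle, particleHole_of_notMem hi, modeEnergy_of_notMem m hi, Function.comp_apply,
      ha]

theorem bogoliubov_creWord_quasiparticle (I₀ : Set ι) {U : H ≃ₗᵢ[ℂ] H} {m : ι → ℝ} {t : ℝ}
    (hU : ∀ i, U (v i) = Complex.exp (Complex.I * t * m i) • v i) (l : List ι) :
    bogoliubov U (creWord (quasiparticle v I₀) l) =
      Complex.exp (Complex.I * t * wordEnergy I₀ m l) • creWord (quasiparticle v I₀) l := by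
  rw [map_creWord (bogoliubov_quasiparticle I₀ hU), prod_star_exp_modeEnergy]

theorem gaugeUnitary_exp_apply (t : ℝ) (x : H) :
    gaugeUnitary H (Circle.exp t) x = Complex.exp (Complex.I * t * (1 : ℝ)) • x := by
  rw [gaugeUnitary_apply, Circle.coe_exp, Complex.ofReal_one, mul_one, mul_comm]

theorem creWord_quasiparticle_mem_gicarSubalgebra {I₀ : Set ι} {l : List ι}
    (hl : wordEnergy I₀ 1 l = 0) : creWord (quasiparticle v I₀) l ∈ gicarSubalgebra H := by
  intro z
  obtain ⟨t, rfl⟩ := Circle.exp_surjective z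
  rw [bogoliubov_creWord_quasiparticle I₀ (m := 1) (t := t)
    fun i => gaugeUnitary_exp_apply t (v i), hl]
  simp

theorem toPreGNS_mem_closure_of_mem_gicarSubalgebra (hv : Orthonormal ℂ v)
    (hd : Dense (Submodule.span ℂ (Set.range v) : Set H)) {I₀ : Set ι} {φ : CARAlgebra H →ₚ[ℂ] ℂ}
    (hφ : IsVacuum φ (quasiparticle v I₀)) {x : CARAlgebra H} (hx : x ∈ gicarSubalgebra H) :
    φ.toPreGNS x ∈ closure (Submodule.span ℂ
      ((φ.toPreGNS ∘ creWord (quasiparticle v I₀)) '' {l | wordEnergy I₀ 1 l = 0}) :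
        Set φ.PreGNS) := by
  have hgauge (t : ℝ) := bogoliubov_quasiparticle I₀ (m := 1) (t := t)
    fun i => gaugeUnitary_exp_apply t (v i)
  refine closure_mono (Submodule.span_mono (Set.image_mono fun l hl => ?_))
    (hφ.toPreGNS_mem_closure_of_fixed (dense_normallyOrdered_quasiparticle hv hd I₀) hgauge
      fun t => hx (Circle.exp t))
  exact eq_zero_of_exp_eq_one fun t => by rw [← prod_star_exp_modeEnergy, hl t]

end CARAlgebra

theorem hasSum_subtype_count_smul {ι M : Type*} [AddCommMonoid M] [TopologicalSpace M]
    [DecidableEq ι] (s : Set ι) (l : List ι) (f : ι → M) :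
    HasSum (fun i : s => l.count (i : ι) • f i) (l.map (s.indicator f)).sum := by
  have hcount : HasSum (fun i => l.count i • s.indicator f i) (l.map (s.indicator f)).sum := by
    rw [Finset.sum_list_map_count]
    refine hasSum_sum_of_ne_finset_zero fun i hi => ?_
    rw [List.count_eq_zero.2 (mt List.mem_toFinset.2 hi), zero_smul]
  refine (hasSum_subtype_iff_indicator (f := fun i => l.count i • f i)).2 (hcount.congr_fun ?_)
  intro i
  by_cases hi : i ∈ s <;> simp [hi]

theorem sum_map_indicator_sub_eq_wordEnergy_smul {ι E : Type*} [AddCommGroup E] [Module ℂ E]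
    (I₀ : Set ι) (m : ι → ℝ) (l : List ι) (x : E) :
    (l.map (I₀ᶜ.indicator fun i => (m i : ℂ) • x)).sum -
      (l.map (I₀.indicator fun i => (m i : ℂ) • x)).sum = (wordEnergy I₀ m l : ℂ) • x := by
  induction l with
  | nil => simp [wordEnergy]
  | cons i l ih =>
    rw [List.map_cons, List.sum_cons, List.map_cons, List.sum_cons, add_sub_add_comm, ih,
      ← List.singleton_append, wordEnergy_append, Complex.ofReal_add, add_smul]
    by_cases hi : i ∈ I₀ <;> simp [wordEnergy, modeEnergy, hi]

namespace GICAR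
variable {H : Type u} [NormedAddCommGroup H] [InnerProductSpace ℂ H] {ι : Type*} {v : ι → H}
  {I₀ : Set ι}

theorem gns_apply_gnsVector (ψ : GICAR H →ₚ[ℂ] ℂ) (x : GICAR H) :
    ψ.gnsStarAlgHom x (gnsVector ψ) = ((ψ.toPreGNS x : ψ.PreGNS) : ψ.GNS) := by
  have hcoe : ψ.gnsStarAlgHom x (gnsVector ψ) = ψ.leftMulMapPreGNS x (ψ.toPreGNS 1) :=
    ψ.gnsNonUnitalStarAlgHom_apply_coe
  rw [hcoe, PositiveLinearMap.leftMulMapPreGNS_apply, PositiveLinearMap.ofPreGNS_toPreGNS, mul_one]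

theorem dense_gns_apply_gnsVector (ψ : GICAR H →ₚ[ℂ] ℂ) :
    Dense (Set.range fun x => ψ.gnsStarAlgHom x (gnsVector ψ)) := by
  have hcoe : (fun x => ψ.gnsStarAlgHom x (gnsVector ψ)) =
      ((↑) : ψ.PreGNS → ψ.GNS) ∘ ψ.toPreGNS := funext (gns_apply_gnsVector ψ)
  rw [hcoe, ψ.toPreGNS.surjective.range_comp]
  exact UniformSpace.Completion.denseRange_coe

/-- The lists of modes of total charge zero, the modes outside `I₀` having charge `1` and those in
`I₀` charge `-1`. They label the gauge-invariant products of quasiparticle creation operators. -/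
abbrev NeutralWord (I₀ : Set ι) : Type _ :=
  {l : List ι // wordEnergy I₀ 1 l = 0}

variable (v I₀) in
/-- The product of the creation operators of the quasiparticles in a list of charge zero. -/
def excitation (l : NeutralWord I₀) : GICAR H :=
  ⟨creWord (CARAlgebra.quasiparticle v I₀) l,
    CARAlgebra.creWord_quasiparticle_mem_gicarSubalgebra l.2⟩

theorem incl_excitation (l : NeutralWord I₀) :
    incl (excitation v I₀ l) = creWord (CARAlgebra.quasiparticle v I₀) l := rfl

variable (v I₀) in
/-- The vector obtained by creating the quasiparticles in a list of charge zero. -/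
def excitationVector (ψ : GICAR H →ₚ[ℂ] ℂ) (l : NeutralWord I₀) : ψ.GNS :=
  ψ.gnsStarAlgHom (excitation v I₀ l) (gnsVector ψ)

theorem incl_monomial {n : ℕ} {α β : Fin n → ι} (hα : ∀ i, α i ∉ I₀) (hβ : ∀ i, β i ∈ I₀) :
    incl (monomial (fun i => v (α i)) fun i => v (β i)) =
      creWord (CARAlgebra.quasiparticle v I₀) (List.ofFn α ++ List.ofFn β) := by
  rw [creWord_append, CARAlgebra.quasiparticle,
    creWord_particleHole_of_notMem (List.forall_mem_ofFn_iff.2 hα),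
    creWord_particleHole_of_mem (List.forall_mem_ofFn_iff.2 hβ), creWord, List.map_ofFn,
    List.map_ofFn]
  rfl

theorem wordEnergy_one_ofFn_append_ofFn {n : ℕ} {α β : Fin n → ι} (hα : ∀ i, α i ∉ I₀)
    (hβ : ∀ i, β i ∈ I₀) : wordEnergy I₀ 1 (List.ofFn α ++ List.ofFn β) = 0 := by
  rw [wordEnergy_append, wordEnergy_one_of_notMem (List.forall_mem_ofFn_iff.2 hα),
    wordEnergy_one_of_mem (List.forall_mem_ofFn_iff.2 hβ), List.length_ofFn, List.length_ofFn,
    add_neg_cancel]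

theorem exists_perm_ofFn_append_ofFn {l : List ι} (hl : wordEnergy I₀ 1 l = 0) :
    ∃ (n : ℕ) (α β : Fin n → ι), (∀ i, α i ∉ I₀) ∧ (∀ i, β i ∈ I₀) ∧
      l.Perm (List.ofFn α ++ List.ofFn β) := by
  classical
  set particles := l.filter (· ∉ I₀)
  set holes := l.filter (· ∈ I₀)
  have hparticles : ∀ i ∈ particles, i ∉ I₀ := fun i hi => by simpa using List.of_mem_filter hi
  have hholes : ∀ i ∈ holes, i ∈ I₀ := fun i hi => by simpa using List.of_mem_filter hi
  have hperm : l.Perm (particles ++ holes) := by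
    simpa [particles, holes] using (List.filter_append_perm (· ∉ I₀) l).symm
  have hlength : holes.length = particles.length := by
    rw [wordEnergy_eq_of_perm 1 hperm, wordEnergy_append, wordEnergy_one_of_notMem hparticles,
      wordEnergy_one_of_mem hholes, add_neg_eq_zero] at hl
    exact_mod_cast hl.symm
  refine ⟨particles.length, particles.get, fun i => holes.get (i.cast hlength.symm),
    fun i => hparticles _ (List.get_mem _ _), fun i => hholes _ (List.get_mem _ _), ?_⟩
  have hofFn : List.ofFn (fun i : Fin particles.length => holes.get (i.cast hlength.symm)) =
      holes := by
    rw [← List.ofFn_congr hlength, List.ofFn_get]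
  rwa [hofFn, List.ofFn_get]

theorem span_range_excitationVector (hv : Orthonormal ℂ v) (ψ : GICAR H →ₚ[ℂ] ℂ) :
    Submodule.span ℂ (Set.range (excitationVector v I₀ ψ)) = excitationSpan ψ v I₀ := by
  refine le_antisymm (Submodule.span_le.2 ?_) (Submodule.span_le.2 ?_)
  · rintro _ ⟨⟨l, hl⟩, rfl⟩
    obtain ⟨n, α, β, hα, hβ, hperm⟩ := exists_perm_ofFn_append_ofFn hl
    have hmem := Submodule.subset_span (R := ℂ) (s := {ξ | ∃ (n : ℕ) (α β : Fin n → ι),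
      (∀ i, α i ∉ I₀) ∧ (∀ i, β i ∈ I₀) ∧ ξ = ψ.gnsStarAlgHom
        (GICAR.monomial (fun i => v (α i)) fun i => v (β i)) (gnsVector ψ)})
      ⟨n, α, β, hα, hβ, rfl⟩
    rcases (CARAlgebra.isModeCAR_quasiparticle hv I₀).creWord_eq_or_eq_neg_of_perm hperm
      with h | h
    · have : excitation v I₀ ⟨l, hl⟩ = monomial (fun i => v (α i)) fun i => v (β i) :=
        Subtype.ext (h.trans (incl_monomial hα hβ).symm)
      rw [excitationVector, this]
      exact hmem
    · have : excitation v I₀ ⟨l, hl⟩ = -monomial (fun i => v (α i)) fun i => v (β i) :=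
        Subtype.ext (h.trans (congrArg Neg.neg (incl_monomial hα hβ)).symm)
      rw [excitationVector, this, map_neg]
      exact neg_mem hmem
  · rintro _ ⟨n, α, β, hα, hβ, rfl⟩
    refine Submodule.subset_span ⟨⟨_, wordEnergy_one_ofFn_append_ofFn hα hβ⟩, ?_⟩
    rw [excitationVector]
    congr 2
    exact Subtype.ext (incl_monomial hα hβ).symm

theorem bogoliubov_excitation {U : H ≃ₗᵢ[ℂ] H} {m : ι → ℝ} {t : ℝ}
    (hU : ∀ i, U (v i) = Complex.exp (Complex.I * t * m i) • v i)
    (l : NeutralWord I₀) :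
    bogoliubov U (excitation v I₀ l) =
      Complex.exp (Complex.I * t * wordEnergy I₀ m l) • excitation v I₀ l :=
  Subtype.ext (CARAlgebra.bogoliubov_creWord_quasiparticle I₀ hU l)

theorem apply_excitationVector_of_isSecondQuantization {m : ι → ℝ} {U : UnitaryGroup H}
    (hU : ∀ (t : ℝ) i, U.toFun t (v i) = Complex.exp (Complex.I * t * m i) • v i)
    {ψ : GICAR H →ₚ[ℂ] ℂ} {V : UnitaryGroup ψ.GNS} (hV : IsSecondQuantization ψ U V) (t : ℝ)
    (l : NeutralWord I₀) : V.toFun t (excitationVector v I₀ ψ l) =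
      Complex.exp (Complex.I * t * wordEnergy I₀ m l) • excitationVector v I₀ ψ l := by
  rw [excitationVector, hV, bogoliubov_excitation (hU t), map_smul, smul_apply]

section Vacuum
variable {φ : CARAlgebra H →ₚ[ℂ] ℂ}

theorem dense_span_excitationVector (hv : Orthonormal ℂ v)
    (hd : Dense (Submodule.span ℂ (Set.range v) : Set H))
    (hφ : IsVacuum φ (CARAlgebra.quasiparticle v I₀)) :
    Dense (Submodule.span ℂ (Set.range (excitationVector v I₀ (restrictGICAR φ))) :
      Set (restrictGICAR φ).GNS) := by
  set ψ := restrictGICAR φ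
  let J : ψ.PreGNS →ₗᵢ[ℂ] φ.PreGNS := preGNSMap incl fun _ => rfl
  let M : Submodule ℂ ψ.PreGNS := Submodule.span ℂ (Set.range (ψ.toPreGNS ∘ excitation v I₀))
  have hM (x : GICAR H) : ψ.toPreGNS x ∈ closure (M : Set ψ.PreGNS) := by
    rw [J.isometry.isUniformInducing.isInducing.closure_eq_preimage_closure_image]
    have himage : (φ.toPreGNS ∘ creWord (CARAlgebra.quasiparticle v I₀)) ''
        {l | wordEnergy I₀ 1 l = 0} = J '' Set.range (ψ.toPreGNS ∘ excitation v I₀) := by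
      rw [Set.image_eq_range, ← Set.range_comp]
      rfl
    have hx := CARAlgebra.toPreGNS_mem_closure_of_mem_gicarSubalgebra hv hd hφ x.2
    rw [himage, ← LinearIsometry.coe_toLinearMap, ← Submodule.map_span] at hx
    exact hx
  have hcoe : M ≤ (Submodule.span ℂ (Set.range (excitationVector v I₀ ψ))).comap
      (UniformSpace.Completion.toComplₗᵢ (𝕜 := ℂ) (E := ψ.PreGNS)).toLinearMap := by
    refine Submodule.span_le.2 (Set.range_subset_iff.2 fun l => Submodule.subset_span ⟨l, ?_⟩)
    exact gns_apply_gnsVector ψ _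
  refine dense_closure.1 ((dense_gns_apply_gnsVector ψ).mono (Set.range_subset_iff.2 fun x => ?_))
  rw [gns_apply_gnsVector]
  exact map_mem_closure (UniformSpace.Completion.continuous_coe _) (hM x) hcoe

theorem gns_apply_gnsVector_eq_zero {b : ι → CARAlgebra H} (hφ : IsVacuum φ b) {x : GICAR H}
    (hx : incl x ∈ Ideal.span (Set.range b)) :
    (restrictGICAR φ).gnsStarAlgHom x (gnsVector (restrictGICAR φ)) = 0 := by
  have hzero : restrictGICAR φ (star x * x) = 0 := hφ.apply_mul_eq_zero hx (star (incl x))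
  rw [gns_apply_gnsVector, ← norm_eq_zero, UniformSpace.Completion.norm_coe,
    PositiveLinearMap.preGNS_norm_def, PositiveLinearMap.ofPreGNS_toPreGNS, hzero,
    Complex.zero_re, Real.sqrt_zero]

theorem gns_apply_excitationVector [DecidableEq ι] (hv : Orthonormal ℂ v)
    (hφ : IsVacuum φ (CARAlgebra.quasiparticle v I₀)) {x : GICAR H} {i : ι}
    (hx : incl x = star (CARAlgebra.quasiparticle v I₀ i) * CARAlgebra.quasiparticle v I₀ i)
    (l : NeutralWord I₀) :
    (restrictGICAR φ).gnsStarAlgHom x (excitationVector v I₀ (restrictGICAR φ) l) =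
      l.1.count i • excitationVector v I₀ (restrictGICAR φ) l := by
  have hcomm : incl (x * excitation v I₀ l - l.1.count i • excitation v I₀ l) =
      creWord (CARAlgebra.quasiparticle v I₀) l * incl x := by
    rw [map_sub, map_mul, map_nsmul, incl_excitation, hx,
      (CARAlgebra.isModeCAR_quasiparticle hv I₀).number_mul_creWord, add_sub_cancel_right]
  have hmem : incl (x * excitation v I₀ l - l.1.count i • excitation v I₀ l) ∈
      Ideal.span (Set.range (CARAlgebra.quasiparticle v I₀)) := by
    rw [hcomm, hx, ← mul_assoc]
    exact Ideal.mul_mem_left _ _ (Ideal.subset_span ⟨i, rfl⟩)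
  have hzero := gns_apply_gnsVector_eq_zero hφ hmem
  rwa [map_sub, map_mul, map_nsmul, sub_apply, sub_eq_zero] at hzero

theorem excitationVector_mem_hamiltonianGraph (hv : Orthonormal ℂ v)
    (hφ : IsVacuum φ (CARAlgebra.quasiparticle v I₀)) (m : ι → ℝ)
    (l : NeutralWord I₀) :
    (excitationVector v I₀ (restrictGICAR φ) l,
      (wordEnergy I₀ m l : ℂ) • excitationVector v I₀ (restrictGICAR φ) l) ∈
      hamiltonianGraph (restrictGICAR φ) v m I₀ := by
  classical
  set ξ := excitationVector v I₀ (restrictGICAR φ) l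
  have hcreAnn (i : ↥(I₀ᶜ)) :
      (restrictGICAR φ).gnsStarAlgHom (creAnn (v i) (v i)) ξ = l.1.count (i : ι) • ξ :=
    gns_apply_excitationVector hv hφ
      (by rw [CARAlgebra.quasiparticle, particleHole_of_notMem i.2]; rfl) l
  have hannCre (i : ↥I₀) :
      (restrictGICAR φ).gnsStarAlgHom (annCre (v i) (v i)) ξ = l.1.count (i : ι) • ξ :=
    gns_apply_excitationVector hv hφ
      (by rw [CARAlgebra.quasiparticle, particleHole_of_mem i.2, star_star]; rfl) l
  refine ⟨(span_range_excitationVector hv _).le (Submodule.subset_span ⟨l, rfl⟩), _, _, ?_, ?_,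
    (sum_map_indicator_sub_eq_wordEnergy_smul I₀ m l ξ).symm⟩
  · refine (hasSum_subtype_count_smul I₀ᶜ l.1 fun i => (m i : ℂ) • ξ).congr_fun fun i => ?_
    rw [hcreAnn, smul_comm]
  · refine (hasSum_subtype_count_smul I₀ l.1 fun i => (m i : ℂ) • ξ).congr_fun fun i => ?_
    rw [hannCre, smul_comm]

theorem graph_hamiltonian (hv : Orthonormal ℂ v)
    (hφ : IsVacuum φ (CARAlgebra.quasiparticle v I₀)) (m : ι → ℝ) :
    (hamiltonian (restrictGICAR φ) v m I₀).graph =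
      eigenGraph (excitationVector v I₀ (restrictGICAR φ)) fun l => wordEnergy I₀ m l := by
  refine graph_eq_eigenGraph (fun ξ hξ => ?_) fun l => ?_
  · rw [span_range_excitationVector hv]
    have hmem := (hamiltonian (restrictGICAR φ) v m I₀).mem_graph ⟨ξ, hξ⟩
    rw [hamiltonian_graph] at hmem
    exact hmem.1
  · rw [hamiltonian_graph]
    exact excitationVector_mem_hamiltonianGraph hv hφ m l

theorem domain_hamiltonian (hv : Orthonormal ℂ v)
    (hφ : IsVacuum φ (CARAlgebra.quasiparticle v I₀)) (m : ι → ℝ) :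
    (hamiltonian (restrictGICAR φ) v m I₀).domain = excitationSpan (restrictGICAR φ) v I₀ := by
  rw [← LinearPMap.graph_map_fst_eq_domain, graph_hamiltonian hv hφ, map_fst_eigenGraph,
    span_range_excitationVector hv]

theorem restrictGICAR_bogoliubov (hv : Orthonormal ℂ v)
    (hd : Dense (Submodule.span ℂ (Set.range v) : Set H))
    (hφ : IsVacuum φ (CARAlgebra.quasiparticle v I₀)) {U : H ≃ₗᵢ[ℂ] H} {m : ι → ℝ} {t : ℝ}
    (hU : ∀ i, U (v i) = Complex.exp (Complex.I * t * m i) • v i) (x : GICAR H) :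
    restrictGICAR φ (bogoliubov U x) = restrictGICAR φ x :=
  hφ.apply_map (CARAlgebra.dense_normallyOrdered_quasiparticle hv hd I₀)
    (CARAlgebra.bogoliubov_quasiparticle I₀ hU) (incl x)

theorem existsUnique_isSecondQuantization (hv : Orthonormal ℂ v)
    (hd : Dense (Submodule.span ℂ (Set.range v) : Set H))
    (hφ : IsVacuum φ (CARAlgebra.quasiparticle v I₀)) {m : ι → ℝ} {U : UnitaryGroup H}
    (hU : ∀ (t : ℝ) i, U.toFun t (v i) = Complex.exp (Complex.I * t * m i) • v i) :
    ∃! V : UnitaryGroup (restrictGICAR φ).GNS, IsSecondQuantization (restrictGICAR φ) U V := by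
  have hinv (t : ℝ) (x : GICAR H) :
      restrictGICAR φ (bogoliubov (U.toFun t) x) = restrictGICAR φ x :=
    restrictGICAR_bogoliubov hv hd hφ (hU t) x
  let T (t : ℝ) : (restrictGICAR φ).GNS →ₗᵢ[ℂ] (restrictGICAR φ).GNS :=
    gnsMap (bogoliubov (U.toFun t)) (hinv t)
  have hT (t : ℝ) (x : GICAR H) :
      T t ((restrictGICAR φ).gnsStarAlgHom x (gnsVector (restrictGICAR φ))) =
        (restrictGICAR φ).gnsStarAlgHom (bogoliubov (U.toFun t) x)
          (gnsVector (restrictGICAR φ)) := by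
    rw [gns_apply_gnsVector, gns_apply_gnsVector]
    exact gnsMap_coe _ _ x
  have htotal := dense_span_excitationVector hv hd hφ
  have heigen (t : ℝ) (l : NeutralWord I₀) :
      T t (excitationVector v I₀ (restrictGICAR φ) l) =
        Complex.exp (Complex.I * t * wordEnergy I₀ m l) •
          excitationVector v I₀ (restrictGICAR φ) l := by
    rw [excitationVector, hT, bogoliubov_excitation (hU t), map_smul, smul_apply]
  obtain ⟨V, hVT⟩ := UnitaryGroup.exists_toFun_eq
    (e := excitationVector v I₀ (restrictGICAR φ)) (μ := fun l => wordEnergy I₀ m l) htotal heigen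
  have hV : IsSecondQuantization (restrictGICAR φ) U V := fun t x => (hVT t _).trans (hT t x)
  refine ⟨V, hV, fun W hW => UnitaryGroup.eq_of_apply_eq htotal fun t l => ?_⟩
  rw [apply_excitationVector_of_isSecondQuantization hU hW,
    apply_excitationVector_of_isSecondQuantization hU hV]

theorem topologicalClosure_graph_hamiltonian (hv : Orthonormal ℂ v)
    (hd : Dense (Submodule.span ℂ (Set.range v) : Set H))
    (hφ : IsVacuum φ (CARAlgebra.quasiparticle v I₀)) {m : ι → ℝ} {U : UnitaryGroup H}
    (hU : ∀ (t : ℝ) i, U.toFun t (v i) = Complex.exp (Complex.I * t * m i) • v i)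
    {V : UnitaryGroup (restrictGICAR φ).GNS} (hV : IsSecondQuantization (restrictGICAR φ) U V) :
    (hamiltonian (restrictGICAR φ) v m I₀).graph.topologicalClosure = V.generator.graph := by
  rw [graph_hamiltonian hv hφ]
  exact (UnitaryGroup.graph_generator_eq (dense_span_excitationVector hv hd hφ)
    (apply_excitationVector_of_isSecondQuantization hU hV)).symm

end Vacuum

end GICAR

section SpanProjection
variable {H : Type u} [NormedAddCommGroup H] [InnerProductSpace ℂ H] [CompleteSpace H]
  {ι : Type*} {v : ι → H} {I₀ : Set ι} {i : ι}

theorem spanProjection_apply_of_mem (hi : i ∈ I₀) : spanProjection v I₀ (v i) = v i :=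
  Submodule.starProjection_eq_self_iff.2
    (Submodule.le_topologicalClosure _ (Submodule.subset_span ⟨i, hi, rfl⟩))

theorem spanProjection_apply_of_notMem (hv : Orthonormal ℂ v) (hi : i ∉ I₀) :
    spanProjection v I₀ (v i) = 0 := by
  refine (Submodule.starProjection_apply_eq_zero_iff _).2 ?_
  rw [Submodule.orthogonal_closure, ← Submodule.span_singleton_le_iff_mem]
  refine Submodule.IsOrtho.symm (Submodule.isOrtho_span.2 ?_)
  rintro _ ⟨j, hj, rfl⟩ _ rfl
  exact hv.2 fun h => hi (h ▸ hj)

theorem IsQuasiFreeState.isVacuum (hv : Orthonormal ℂ v) {φ : CARAlgebra H →ₚ[ℂ] ℂ}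
    (hφ : IsQuasiFreeState (spanProjection v I₀) φ) :
    IsVacuum φ (CARAlgebra.quasiparticle v I₀) := by
  intro i
  by_cases hi : i ∈ I₀
  · rw [CARAlgebra.quasiparticle, particleHole_of_mem hi, star_star,
      (CARAlgebra.isCAR_a.isModeCAR hv).mul_star_self, map_sub, hφ.map_one, Function.comp_apply,
      hφ.two_point, spanProjection_apply_of_mem hi, inner_self_eq_norm_sq_to_K, hv.1 i]
    simp
  · rw [CARAlgebra.quasiparticle, particleHole_of_notMem hi, Function.comp_apply, hφ.two_point,
      spanProjection_apply_of_notMem hv hi, inner_zero_right]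

end SpanProjection

end

theorem theorem4p4_general {H : Type*} [NormedAddCommGroup H] [InnerProductSpace ℂ H]
    [CompleteSpace H] {ι : Type*} (A : H →ₗ.[ℂ] H) (hA : IsSelfAdjoint A)
    (v : HilbertBasis ι ℂ H) (m : ι → ℝ)
    (hv : ∀ α, ∃ hα : v α ∈ A.domain, A ⟨v α, hα⟩ = (m α : ℂ) • v α) (I₀ : Set ι) :
    (∃! U : UnitaryGroup H, U.generator = A) ∧
    ∀ U : UnitaryGroup H, U.generator = A →
      (∃! V : UnitaryGroup (projectionState v I₀).GNS,
        IsSecondQuantization (projectionState v I₀) U V) ∧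
      ∀ V : UnitaryGroup (projectionState v I₀).GNS,
        IsSecondQuantization (projectionState v I₀) U V →
        (hamiltonian (projectionState v I₀) v m I₀).domain =
          excitationSpan (projectionState v I₀) v I₀ ∧
        (hamiltonian (projectionState v I₀) v m I₀).IsClosable ∧
        (hamiltonian (projectionState v I₀) v m I₀).closure = V.generator := by
  have hd := hilbertBasis_dense_span v
  have hφ := (isQuasiFreeState_quasiFreeState _ (spanProjection_nonneg v I₀)
    (spanProjection_le_one v I₀)).isVacuum v.orthonormal
  have hAv (i : ι) : (v i, (m i : ℂ) • v i) ∈ A.graph := by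
    obtain ⟨hα, hAα⟩ := hv i
    exact hAα ▸ A.mem_graph ⟨v i, hα⟩
  refine ⟨existsUnique_generator_eq hA hAv, fun U hU => ?_⟩
  have hUv (t : ℝ) (i : ι) : U.toFun t (v i) = Complex.exp (Complex.I * t * m i) • v i :=
    UnitaryGroup.apply_eq_exp_smul_iff.2 (by rw [← U.generator_graph, hU]; exact hAv i) t
  refine ⟨GICAR.existsUnique_isSecondQuantization v.orthonormal hd hφ hUv, fun V hV => ?_⟩
  have hgraph : (hamiltonian (projectionState v I₀) v m I₀).graph.topologicalClosure =
      V.generator.graph :=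
    GICAR.topologicalClosure_graph_hamiltonian v.orthonormal hd hφ hUv hV
  have hclosable : (hamiltonian (projectionState v I₀) v m I₀).IsClosable := ⟨_, hgraph⟩
  refine ⟨GICAR.domain_hamiltonian v.orthonormal hφ m, hclosable, ?_⟩
  exact LinearPMap.eq_of_eq_graph (hclosable.graph_closure_eq_closure_graph.symm.trans hgraph)

theorem theorem4p4 {H : Type*} [NormedAddCommGroup H] [InnerProductSpace ℂ H] [CompleteSpace H]
    {ι : Type*} [Countable ι] (A : H →ₗ.[ℂ] H) (hA : IsSelfAdjoint A)
    (v : HilbertBasis ι ℂ H) (m : ι → ℝ)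
    (hv : ∀ α, ∃ hα : v α ∈ A.domain, A ⟨v α, hα⟩ = (m α : ℂ) • v α) (I₀ : Set ι) :
    (∃! U : UnitaryGroup H, U.generator = A) ∧
    ∀ U : UnitaryGroup H, U.generator = A →
      (∃! V : UnitaryGroup (projectionState v I₀).GNS,
        IsSecondQuantization (projectionState v I₀) U V) ∧
      ∀ V : UnitaryGroup (projectionState v I₀).GNS,
        IsSecondQuantization (projectionState v I₀) U V →
        (hamiltonian (projectionState v I₀) v m I₀).domain =
          excitationSpan (projectionState v I₀) v I₀ ∧
        (hamiltonian (projectionState v I₀) v m I₀).IsClosable ∧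
        (hamiltonian (projectionState v I₀) v m I₀).closure = V.generator :=
  theorem4p4_general A hA v m hv I₀
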